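/- Let $\mathds N$ be the set of functions $\Psi:[0,\infty)\to\mathbb R$ of the form $$\Psi(u)=-\kappa+au+\tfrac12\sigma^2u^2-\int_{(0,\infty)}\bigl(1-e^{-ur}-ur\,\mathbb 1_{\{r<1\}}\bigr)\,\mu(dr),$$ with $\kappa\ge 0$, $a\in\mathbb R$, $\sigma\in\mathbb R$ and $\mu$ a measure on $(0,\infty)$ with $\int\min(1,r^2)\,\mu(dr)<\infty$, excluding the case where simultaneously $\sigma=0$, $\int\min(1,r)\,\mu(dr)<\infty$ and $a+\int_{(0,1)}r\,\mu(dr)\le 0$. Let $\mathds N_{\mathds D}$ be the set of $\Psi\in\mathds N$ whose largest zero $\sup\{u\ge0:\Psi(u)=0\}$ lies in $[0,\tfrac12]$, and for $\Psi\in\mathds N_{\mathds D}$ put $$\mathcal J_\Psi(z)=\sum_{n=0}^\infty\frac{(-1)^n}{\Psi(1)\cdots\Psi(n)}\,z^{2n},\qquad z\in\mathbb C.$$ A measurable function $\ell:(0,\infty)\to\mathbb R$ is slowly varying at infinity if $\lim_{t\to\infty}\ell(ut)/\ell(t)=1$ for every $u>0$. Write $M_f(r)=\max_{|z|=r}|f(z)|$.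 The order of an entire function $f$ is $\limsup_{r\to\infty}\log\log M_f(r)/\log r$, and its type, if its order $\rho$ is positive and finite, is $\limsup_{r\to\infty}r^{-\rho}\log M_f(r)$. A Bernstein function is a $C^\infty$ function $\phi:(0,\infty)\to[0,\infty)$ with $(-1)^{n+1}\phi^{(n)}\ge0$ for all $n\ge1$; it is special, with conjugate $\widehat\phi$, if $\widehat\phi$ is a Bernstein function and $\phi(u)\widehat\phi(u)=u$ for all $u>0$. **Proposition.** Let $\Psi\in\mathds N_{\mathds D}$. 1. Suppose that there is a function $\ell$, slowly varying at infinity with $\lim_{u\to\infty}\ell(u)=\infty$, such that $\Psi(u)=u^2/\ell(u)$ for all sufficiently large $u$. Then the series $\mathcal J_\Psi$ converges on $\mathbb C$ and is an entire function of order $1$ and infinite type. Moreover, its restriction to $\mathbb R$ is the characteristic function of a probability measure that has a density with respect to Lebesgue measure and whose support is $\mathbb R$. 2. The condition in 1 holds when $\Psi(u)=(u-\theta)\phi(u)$ for all $u>0$, where $\theta\ge0$ and $\phi$ is a special Bernstein function whose conjugate $\widehat\phi$ is slowly varying at infinity with $\lim_{u\to\infty}\widehat\phi(u)=\infty$. More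 precisely, $\Psi(u)=u^2/\ell(u)$ for all $u>\theta$ with $\ell(u)=\frac{u}{u-\theta}\,\widehat\phi(u)$ for $u>\theta$ (so $\ell=\widehat\phi$ if $\theta=0$), and $\ell$ is slowly varying at infinity with $\ell(u)\to\infty$. -/

import Mathlib

open MeasureTheory Set Filter Topology
open scoped ContDiff

noncomputable section

namespace VanDantzig

/-- The Lévy–Khintchine form with characteristics `(κ, a, σ, μ)`; the Lévy measure is the
restriction of `μ` to `(0, ∞)`. -/
def levyKhintchine (κ a σ : ℝ) (μ : Measure ℝ) (u : ℝ) : ℝ :=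
  -κ + a * u + σ ^ 2 / 2 * u ^ 2
    - ∫ r in Ioi (0 : ℝ), (1 - Real.exp (-(u * r)) - (Iio (1 : ℝ)).indicator (fun s => u * s) r) ∂μ

/-- The set `N`: `Ψ`, seen as a function on `[0, ∞)`, is the Laplace exponent of a possibly killed
spectrally negative Lévy process whose paths are not non-increasing. -/
def IsLaplaceExponent (Ψ : ℝ → ℝ) : Prop :=
  ∃ (κ a σ : ℝ) (μ : Measure ℝ),
    0 ≤ κ ∧
    (∫⁻ r in Ioi (0 : ℝ), ENNReal.ofReal (min 1 (r ^ 2)) ∂μ) < ⊤ ∧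
    ¬ (σ = 0 ∧ (∫⁻ r in Ioi (0 : ℝ), ENNReal.ofReal (min 1 r) ∂μ) < ⊤ ∧
        a + (∫ r in Ioo (0 : ℝ) 1, r ∂μ) ≤ 0) ∧
    ∀ u : ℝ, 0 ≤ u → Ψ u = levyKhintchine κ a σ μ u

/-- The largest zero `θ = sup {u ≥ 0 : Ψ u = 0}`. For `Ψ` in `N` this set is nonempty and bounded. -/
def largestZero (Ψ : ℝ → ℝ) : ℝ := sSup {u : ℝ | 0 ≤ u ∧ Ψ u = 0}

/-- The set `N_D`: elements of `N` with `0 ≤ θ ≤ 1/2`. -/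
def MemND (Ψ : ℝ → ℝ) : Prop :=
  IsLaplaceExponent Ψ ∧ 0 ≤ largestZero Ψ ∧ largestZero Ψ ≤ 1 / 2

/-- The general term `(-1)^n z^(2n) / (Ψ(1) ⋯ Ψ(n))`. -/
def seriesTerm (Ψ : ℝ → ℝ) (z : ℂ) (n : ℕ) : ℂ :=
  (-1) ^ n / ((∏ k ∈ Finset.Icc 1 n, Ψ (k : ℝ) : ℝ) : ℂ) * z ^ (2 * n)

/-- The function `J_Ψ`. -/
def J (Ψ : ℝ → ℝ) (z : ℂ) : ℂ := ∑' n : ℕ, seriesTerm Ψ z n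

/-- Slowly varying at infinity, for a measurable function on `(0, ∞)`. -/
def IsSlowlyVarying (l : ℝ → ℝ) : Prop :=
  Measurable (fun u : Ioi (0 : ℝ) => l u) ∧
    ∀ u : ℝ, 0 < u → Tendsto (fun t : ℝ => l (u * t) / l t) atTop (𝓝 1)

/-- Bernstein functions on `(0, ∞)`. -/
def IsBernstein (φ : ℝ → ℝ) : Prop :=
  ContDiffOn ℝ ∞ φ (Ioi 0) ∧ (∀ u : ℝ, 0 < u → 0 ≤ φ u) ∧
    ∀ n : ℕ, 1 ≤ n → ∀ u : ℝ, 0 < u → 0 ≤ (-1) ^ (n + 1) * iteratedDeriv n φ u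

/-- `φ` is a special Bernstein function with conjugate Bernstein function `ψ`. -/
def IsSpecialBernsteinWithConjugate (φ ψ : ℝ → ℝ) : Prop :=
  IsBernstein φ ∧ IsBernstein ψ ∧ ∀ u : ℝ, 0 < u → φ u * ψ u = u

/-- The maximum modulus `max_{|z| = r} |f z|`. -/
def maxModulus (f : ℂ → ℂ) (r : ℝ) : ℝ := sSup ((fun z => ‖f z‖) '' Metric.sphere (0 : ℂ) r)

/-- The order of an entire function. -/
def entireOrder (f : ℂ → ℂ) : EReal :=
  limsup (fun r : ℝ => ((Real.log (Real.log (maxModulus f r)) / Real.log r : ℝ) : EReal)) atTop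

/-- The type of an entire function with respect to the (finite, positive) order `ρ`. -/
def entireType (f : ℂ → ℂ) (ρ : ℝ) : EReal :=
  limsup (fun r : ℝ => ((Real.log (maxModulus f r) / r ^ ρ : ℝ) : EReal)) atTop

end VanDantzig

end

/-! Put h(k) = 2k(2k-1)/Ψ(k) and b(n) = h(1)⋯h(n). Then J(z) = ∑ (-1)^n b(n) z^(2n)/(2n)!, so J is a
cosine series whose coefficients are modified by the slowly growing weights b(n).

Everything rests on 1/h being the Laplace transform, at positive integers, of a measure ρ on (0, ∞)
with a density (`exists_isLaplaceInverse_coeffRatio`). The largest zero being at most 1/2 makes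
Ψ(1/2) ≥ 0, hence the density nonnegative; ℓ → ∞ kills the Gaussian part, which would be an atom of
ρ at 0. Hence h is nondecreasing, and h(k) ~ 4ℓ(k) tends slowly to infinity.

Tilting ρ by e^(-ky) and normalizing gives a law under which e^(-y/2) has even moments h(k)/h(k+n).
A random sign times independent factors with k = m+1, …, m+N, rescaled by √h(m+N+1), has a
characteristic function converging to the even series with weights h(m+1)⋯h(m+n). Lévy's continuity
theorem yields the laws λ_m (`IsLaplaceInverse.exists_law`), and λ_0 has characteristic function J.

The laws satisfy λ_m = law of e^(-y/2) times an independent λ_(m+1) variable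
(`IsLaplaceInverse.law_eq_mulLaw`), and λ_m divided by √h(m+1) tends to the random sign
(`IsLaplaceInverse.tendsto_rescaled_law`). Thus there is no atom at 0, and one factor with a density
makes λ_0 absolutely continuous. Points of supp λ_m near ±√h(m+1) can be shrunk by m factors, that
is exponentially in m, while h grows subexponentially: every real number is reached
(`IsLaplaceInverse.support_law`).

For the growth, the maximum modulus is attained on the imaginary axis. There b(n) ≥ cK^n for every K
gives infinite type, and b(n) ≤ C^n (n!)^ε for every ε gives order at most 1. -/

namespace VanDantzig

/-! ### Slowly increasing sequences and the growth of their products -/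

/-- The products `h (m + 1) ⋯ h (m + n)`. -/
noncomputable def shiftedProd (h : ℕ → ℝ) (m n : ℕ) : ℝ := ∏ j ∈ Finset.range n, h (m + j + 1)

/-- A positive, nondecreasing sequence on `k ≥ 1` which varies slowly along doublings. -/
structure SlowlyIncreasing (h : ℕ → ℝ) : Prop where
  pos : ∀ k, 1 ≤ k → 0 < h k
  mono : ∀ k l, 1 ≤ k → k ≤ l → h k ≤ h l
  double : Tendsto (fun k => h (2 * k) / h k) atTop (𝓝 1)

variable {h : ℕ → ℝ}

/-- A Potter bound: far out, each doubling costs at most a factor 2^ε. Rounding k up to a power of 2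
costs one extra doubling, the constant 2^ε. -/
lemma SlowlyIncreasing.le_rpow_mul (H : SlowlyIncreasing h) {ε : ℝ} (hε : 0 < ε) :
    ∃ v₀, 1 ≤ v₀ ∧ ∀ v, v₀ ≤ v → ∀ k : ℕ, 1 ≤ k → h (k * v) ≤ 2 ^ ε * (k : ℝ) ^ ε * h v := by
  have h1 : (1 : ℝ) < 2 ^ ε := Real.one_lt_rpow (by norm_num) hε
  obtain ⟨v₀, hv₀⟩ := eventually_atTop.1 (H.double.eventually (gt_mem_nhds h1))
  refine ⟨max 1 v₀, le_max_left _ _, fun v hv k hk => ?_⟩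
  have hv1 : 1 ≤ v := (le_max_left _ _).trans hv
  have hv2 : v₀ ≤ v := (le_max_right _ _).trans hv
  have key : ∀ i : ℕ, h (2 ^ i * v) ≤ (2 ^ ε : ℝ) ^ i * h v := by
    intro i
    induction i with
    | zero => simp
    | succ i ih =>
      have hle : v ≤ 2 ^ i * v := Nat.le_mul_of_pos_left _ (by positivity)
      have hp : 0 < h (2 ^ i * v) := H.pos _ (hv1.trans hle)
      have := (div_lt_iff₀ hp).1 (hv₀ (2 ^ i * v) (hv2.trans hle))
      calc h (2 ^ (i + 1) * v) = h (2 * (2 ^ i * v)) := by congr 1; ring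
        _ ≤ 2 ^ ε * h (2 ^ i * v) := this.le
        _ ≤ 2 ^ ε * ((2 ^ ε : ℝ) ^ i * h v) := by gcongr
        _ = _ := by ring
  set i := Nat.log 2 k
  have hi1 : k < 2 ^ (i + 1) := Nat.lt_pow_succ_log_self (by norm_num) k
  have hi2 : 2 ^ i ≤ k := Nat.pow_log_le_self 2 (by omega)
  have hhv := H.pos v hv1
  calc h (k * v) ≤ h (2 ^ (i + 1) * v) :=
        H.mono _ _ (Nat.mul_pos hk hv1) (Nat.mul_le_mul_right _ hi1.le)
    _ ≤ (2 ^ ε : ℝ) ^ (i + 1) * h v := key _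
    _ = 2 ^ ε * ((2 ^ i : ℝ)) ^ ε * h v := by
        rw [pow_succ, ← Real.rpow_natCast, ← Real.rpow_natCast, ← Real.rpow_mul (by norm_num),
          ← Real.rpow_mul (by norm_num), mul_comm ε]
        ring
    _ ≤ 2 ^ ε * (k : ℝ) ^ ε * h v := by
        gcongr
        exact_mod_cast hi2

lemma SlowlyIncreasing.le_const_mul_rpow (H : SlowlyIncreasing h) {ε : ℝ} (hε : 0 < ε) :
    ∃ C : ℝ, 0 < C ∧ ∀ k : ℕ, 1 ≤ k → h k ≤ C * (k : ℝ) ^ ε := by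
  obtain ⟨v, hv, hh⟩ := H.le_rpow_mul hε
  refine ⟨2 ^ ε * h v, by have := H.pos v hv; positivity, fun k hk => ?_⟩
  calc h k ≤ h (k * v) := H.mono _ _ hk (Nat.le_mul_of_pos_right _ hv)
    _ ≤ _ := hh v le_rfl k hk
    _ = _ := by ring

lemma shiftedProd_pos (H : SlowlyIncreasing h) (m n : ℕ) : 0 < shiftedProd h m n :=
  Finset.prod_pos fun _ _ => H.pos _ (by omega)

/-- The inequality m + n + 1 ≤ (m + 1)(n + 1) separates the shift from the running index, leaving a
power and a factorial. -/
lemma shiftedProd_le (H : SlowlyIncreasing h) {ε : ℝ} (hε : 0 < ε) :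
    ∃ C : ℝ, 0 < C ∧ ∀ m n : ℕ,
      shiftedProd h m n ≤ (C * ((m : ℝ) + 1) ^ ε) ^ n * (n.factorial : ℝ) ^ ε := by
  obtain ⟨C, hC, hh⟩ := H.le_const_mul_rpow hε
  refine ⟨C, hC, fun m n => ?_⟩
  induction n with
  | zero => simp [shiftedProd]
  | succ n ih =>
    have h1 : h (m + n + 1) ≤ C * ((m : ℝ) + 1) ^ ε * ((n : ℝ) + 1) ^ ε := by
      refine (hh _ (by omega)).trans ?_
      rw [mul_assoc, ← Real.mul_rpow (by positivity) (by positivity)]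
      gcongr
      push_cast
      nlinarith [(by positivity : (0 : ℝ) ≤ (m : ℝ) * n)]
    have h2 := H.pos (m + n + 1) (by omega)
    rw [shiftedProd, Finset.prod_range_succ, ← shiftedProd]
    calc _ ≤ ((C * ((m : ℝ) + 1) ^ ε) ^ n * (n.factorial : ℝ) ^ ε) *
          (C * ((m : ℝ) + 1) ^ ε * ((n : ℝ) + 1) ^ ε) := by gcongr
      _ = _ := by
        rw [Nat.factorial_succ]
        push_cast
        rw [Real.mul_rpow (by positivity) (by positivity)]
        ring

/-- The coefficients `b n / (2 n)!` define an entire function. -/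
def EvenSummable (b : ℕ → ℝ) : Prop :=
  ∀ r : ℝ, Summable fun n : ℕ => |b n| / ((2 * n).factorial : ℝ) * r ^ (2 * n)

lemma factorial_sq_le (n : ℕ) : ((n.factorial : ℝ)) ^ 2 ≤ ((2 * n).factorial : ℝ) := by
  have := Nat.factorial_mul_factorial_dvd_factorial_add n n
  have := Nat.le_of_dvd (Nat.factorial_pos _) this
  rw [two_mul, sq]
  exact_mod_cast this

lemma evenSummable_of_le_mul_factorial {b : ℕ → ℝ} {C : ℝ}
    (hb : ∀ n, |b n| ≤ C ^ n * (n.factorial : ℝ)) : EvenSummable b := by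
  intro r
  refine Summable.of_nonneg_of_le (fun n => ?_) (fun n => ?_)
    (Real.summable_pow_div_factorial (C * r ^ 2))
  · rw [pow_mul]; positivity
  · have h1 := factorial_sq_le n
    have h2 : (0 : ℝ) < n.factorial := by positivity
    rw [pow_mul, mul_pow]
    calc |b n| / ((2 * n).factorial : ℝ) * (r ^ 2) ^ n
        ≤ (C ^ n * (n.factorial : ℝ)) / ((n.factorial : ℝ)) ^ 2 * (r ^ 2) ^ n := by
          have := (abs_nonneg _).trans (hb n)
          gcongr
          exact hb n
      _ = _ := by field_simp

lemma SlowlyIncreasing.evenSummable (H : SlowlyIncreasing h) (m : ℕ) :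
    EvenSummable (shiftedProd h m) := by
  obtain ⟨C, hC, hh⟩ := shiftedProd_le H one_pos
  refine evenSummable_of_le_mul_factorial (C := C * ((m : ℝ) + 1) ^ (1 : ℝ)) fun n => ?_
  rw [abs_of_pos (shiftedProd_pos H m n)]
  simpa using hh m n

end VanDantzig

/-! ### Even power series, product laws and Lévy continuity -/

namespace VanDantzig

/-- The even power series `∑ (-1)^n b n z^(2 n) / (2 n)!`. -/
noncomputable def evenSeries (b : ℕ → ℝ) (z : ℂ) : ℂ :=
  ∑' n : ℕ, (((-1) ^ n * b n / ((2 * n).factorial : ℝ) : ℝ) : ℂ) * z ^ (2 * n)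

lemma norm_evenSeries_term (b : ℕ → ℝ) (z : ℂ) (n : ℕ) :
    ‖(((-1) ^ n * b n / ((2 * n).factorial : ℝ) : ℝ) : ℂ) * z ^ (2 * n)‖ =
      |b n| / ((2 * n).factorial : ℝ) * ‖z‖ ^ (2 * n) := by
  rw [norm_mul, Complex.norm_real, norm_pow, norm_div, norm_mul, norm_pow]
  simp

lemma EvenSummable.summable {b : ℕ → ℝ} (hb : EvenSummable b) (z : ℂ) :
    Summable fun n : ℕ => (((-1) ^ n * b n / ((2 * n).factorial : ℝ) : ℝ) : ℂ) * z ^ (2 * n) := by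
  refine Summable.of_norm ?_
  simp_rw [norm_evenSeries_term]
  exact hb _

lemma EvenSummable.differentiable {b : ℕ → ℝ} (hb : EvenSummable b) :
    Differentiable ℂ (evenSeries b) := by
  intro z
  have hz : z ∈ Metric.ball (0 : ℂ) (‖z‖ + 1) := by simp
  refine DifferentiableOn.differentiableAt ?_ (Metric.isOpen_ball.mem_nhds hz)
  refine Complex.differentiableOn_tsum_of_summable_norm (hb (‖z‖ + 1))
    (fun n => (by fun_prop : Differentiable ℂ _).differentiableOn) Metric.isOpen_ball ?_
  intro n w hw
  rw [norm_evenSeries_term]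
  have : ‖w‖ ≤ ‖z‖ + 1 := by simpa using (mem_ball_zero_iff.1 hw).le
  gcongr

lemma EvenSummable.mono {b B : ℕ → ℝ} (hB : EvenSummable B) (h : ∀ n, |b n| ≤ B n) :
    EvenSummable b := by
  intro r
  refine Summable.of_nonneg_of_le (fun n => ?_) (fun n => ?_) (hB r)
  · rw [pow_mul]; positivity
  · rw [pow_mul]
    have := (h n).trans (le_abs_self _)
    gcongr

lemma tendsto_evenSeries {ι : Type*} {l : Filter ι} [l.NeBot] {b : ι → ℕ → ℝ}
    {b₀ B : ℕ → ℝ} (hB : EvenSummable B) (hb : ∀ᶠ i in l, ∀ n, |b i n| ≤ B n)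
    (hlim : ∀ n, Tendsto (fun i => b i n) l (𝓝 (b₀ n))) (z : ℂ) :
    Tendsto (fun i => evenSeries (b i) z) l (𝓝 (evenSeries b₀ z)) := by
  refine tendsto_tsum_of_dominated_convergence (hB ‖z‖) (fun n => ?_) ?_
  · refine Tendsto.mul_const _ ?_
    refine (Complex.continuous_ofReal.tendsto _).comp ?_
    exact ((hlim n).const_mul _).div_const _
  · filter_upwards [hb] with i hi n
    rw [norm_evenSeries_term]
    have := (hi n).trans (le_abs_self _)
    gcongr

lemma evenSeries_mul (b : ℕ → ℝ) (c : ℝ) (z : ℂ) :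
    evenSeries b (c * z) = evenSeries (fun n => c ^ (2 * n) * b n) z := by
  refine tsum_congr fun n => ?_
  push_cast
  rw [mul_pow]
  ring

lemma evenSeries_one (z : ℂ) : evenSeries (fun _ => 1) z = Complex.cos z := by
  rw [Complex.cos_eq_tsum]
  refine tsum_congr fun n => ?_
  push_cast
  ring

/-- The symmetric Bernoulli distribution on `{-1, 1}`. -/
noncomputable def rademacher : Measure ℝ :=
  (2⁻¹ : ENNReal) • (Measure.dirac 1 + Measure.dirac (-1))

instance : IsProbabilityMeasure rademacher := by
  constructor
  simp only [rademacher, Measure.smul_apply, Measure.add_apply, measure_univ, smul_eq_mul]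
  rw [one_add_one_eq_two]
  exact ENNReal.inv_mul_cancel (by norm_num) (by norm_num)

lemma charFun_rademacher (t : ℝ) : charFun rademacher t = evenSeries (fun _ => 1) t := by
  rw [evenSeries_one, charFun_apply_real, rademacher, integral_smul_measure,
    integral_add_measure (integrable_dirac (by simp)) (integrable_dirac (by simp)),
    integral_dirac, integral_dirac, Complex.cos]
  simp
  ring_nf

/-- The law of the product `X W` with `X` on `(ℝ, Q)` and `W` of law `ν` independent. -/
noncomputable def mulLaw (Q : Measure ℝ) (X : ℝ → ℝ) (ν : Measure ℝ) : Measure ℝ :=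
  (Q.prod ν).map fun p => X p.1 * p.2

lemma isProbabilityMeasure_mulLaw {Q : Measure ℝ} [IsProbabilityMeasure Q] {X : ℝ → ℝ}
    (hX : Measurable X) {ν : Measure ℝ} [IsProbabilityMeasure ν] :
    IsProbabilityMeasure (mulLaw Q X ν) :=
  Measure.isProbabilityMeasure_map (by fun_prop)

/-- Integrating over W first leaves the series at tX; the bound |X| ≤ 1 then allows termwise
integration, so an independent factor multiplies each weight by an even moment. -/
lemma charFun_mulLaw {Q : Measure ℝ} [IsProbabilityMeasure Q] {X : ℝ → ℝ}
    (hX : Measurable X) (hX1 : ∀ᵐ y ∂Q, |X y| ≤ 1) {ν : Measure ℝ} [IsProbabilityMeasure ν]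
    {b : ℕ → ℝ} (hb : EvenSummable b) (hν : ∀ t : ℝ, charFun ν t = evenSeries b t) (t : ℝ) :
    charFun (mulLaw Q X ν) t = evenSeries (fun n => (∫ y, X y ^ (2 * n) ∂Q) * b n) t := by
  rw [charFun_apply_real, mulLaw, integral_map (by fun_prop)
    (Measurable.aestronglyMeasurable (by fun_prop)), integral_prod]
  swap
  · refine Integrable.of_bound (C := 1) (Measurable.aestronglyMeasurable (by fun_prop)) ?_
    refine Eventually.of_forall fun p => ?_
    have : (t * ((X p.1 * p.2 : ℝ) : ℂ) * Complex.I) = ((t * (X p.1 * p.2) : ℝ) : ℂ) * Complex.I := by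
      push_cast; ring
    rw [this, Complex.norm_exp_ofReal_mul_I]
  have h1 : ∀ y, ∫ w, Complex.exp (t * ((X y * w : ℝ) : ℂ) * Complex.I) ∂ν =
      ∑' n : ℕ, (((-1) ^ n * b n / ((2 * n).factorial : ℝ) * (t * X y) ^ (2 * n) : ℝ) : ℂ) := by
    intro y
    have h2 := hν (t * X y)
    rw [charFun_apply_real, evenSeries] at h2
    push_cast at h2 ⊢
    rw [← h2]
    refine integral_congr_ae (Eventually.of_forall fun w => ?_)
    dsimp only
    congr 1
    ring
  simp only [h1]
  have hint : ∀ n : ℕ, Integrable (fun y => X y ^ (2 * n)) Q := by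
    intro n
    refine Integrable.of_bound (C := 1) (hX.pow_const _).aestronglyMeasurable ?_
    filter_upwards [hX1] with y hy
    rw [Real.norm_eq_abs, abs_pow]
    exact pow_le_one₀ (abs_nonneg _) hy
  have hint2 : ∀ n : ℕ, Integrable
      (fun y => (((-1) ^ n * b n / ((2 * n).factorial : ℝ) * (t * X y) ^ (2 * n) : ℝ) : ℂ)) Q := by
    intro n
    refine Integrable.ofReal ?_
    simp_rw [mul_pow]
    exact ((hint n).const_mul _).const_mul _
  rw [← integral_tsum_of_summable_integral_norm hint2]
  · refine tsum_congr fun n => ?_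
    rw [integral_complex_ofReal]
    simp_rw [mul_pow]
    rw [integral_const_mul, integral_const_mul]
    push_cast
    ring
  · refine Summable.of_nonneg_of_le (fun n => integral_nonneg fun y => norm_nonneg _)
      (fun n => ?_) (hb |t|)
    have : ∀ᵐ y ∂Q, ‖(((-1) ^ n * b n / ((2 * n).factorial : ℝ) * (t * X y) ^ (2 * n) : ℝ) : ℂ)‖
        ≤ |b n| / ((2 * n).factorial : ℝ) * |t| ^ (2 * n) := by
      filter_upwards [hX1] with y hy
      have := norm_evenSeries_term b ((t * X y : ℝ) : ℂ) n
      rw [← Complex.ofReal_pow, ← Complex.ofReal_mul] at this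
      rw [this, Complex.norm_real, Real.norm_eq_abs, abs_mul]
      gcongr
      exact mul_le_of_le_one_right (abs_nonneg _) hy
    calc _ ≤ ∫ y, |b n| / ((2 * n).factorial : ℝ) * |t| ^ (2 * n) ∂Q :=
          integral_mono_ae (hint2 n).norm (integrable_const _) this
      _ = _ := by simp

/-- Lévy's continuity theorem: continuity at 0 gives tightness, Prokhorov gives a cluster point, and
its characteristic function is read off along an ultrafilter. -/
lemma exists_charFun_eq_of_tendsto {ν : ℕ → Measure ℝ} (hν : ∀ i, IsProbabilityMeasure (ν i))
    {F : ℝ → ℂ} (hF : ContinuousAt F 0)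
    (h : ∀ t, Tendsto (fun n => charFun (ν n) t) atTop (𝓝 (F t))) :
    ∃ lam : Measure ℝ, IsProbabilityMeasure lam ∧ ∀ t, charFun lam t = F t := by
  have ht := isTightMeasureSet_of_tendsto_charFun hF h
  let μ : ℕ → ProbabilityMeasure ℝ := fun n => ⟨ν n, hν n⟩
  have hc : IsCompact (closure (range μ)) := by
    refine isCompact_closure_of_isTightMeasureSet (ht.subset ?_)
    rintro _ ⟨_, ⟨n, rfl⟩, rfl⟩
    exact ⟨n, rfl⟩
  obtain ⟨lam, -, hl⟩ := hc.exists_clusterPt (f := map μ atTop)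
    (le_principal_iff.2 (mem_map.2 (Eventually.of_forall fun n => subset_closure ⟨n, rfl⟩)))
  refine ⟨lam, inferInstance, fun t => ?_⟩
  obtain ⟨U, hU, hUl⟩ := mapClusterPt_iff_ultrafilter.1 hl
  have h1 : Tendsto (fun n => charFun (ν n) t) U (𝓝 (charFun (lam : Measure ℝ) t)) := by
    have := (ProbabilityMeasure.tendsto_iff_forall_integral_rclike_tendsto ℂ).1 hUl
      (BoundedContinuousFunction.innerProbChar t)
    simp only [charFun_eq_integral_innerProbChar]
    exact this
  exact tendsto_nhds_unique h1 ((h t).mono_left hU)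

end VanDantzig

/-! ### Tilted factors and the laws built from them -/

namespace VanDantzig

/-- `1 / h` is, on the positive integers, the Laplace transform of a measure `ρ` on `(0, ∞)`. -/
structure IsLaplaceInverse (ρ : Measure ℝ) (h : ℕ → ℝ) : Prop where
  slow : SlowlyIncreasing h
  pos_ae : ∀ᵐ y ∂ρ, 0 < y
  laplace : ∀ k : ℕ, 1 ≤ k →
    ∫⁻ y, ENNReal.ofReal (Real.exp (-(k * y))) ∂ρ = ENNReal.ofReal (h k)⁻¹

/-- The exponentially tilted and normalized measure. -/
noncomputable def tilt (ρ : Measure ℝ) (h : ℕ → ℝ) (k : ℕ) : Measure ℝ :=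
  ρ.withDensity fun y => ENNReal.ofReal (h k * Real.exp (-(k * y)))

/-- The factor `e^(-y/2)`. -/
noncomputable def expHalf (y : ℝ) : ℝ := Real.exp (-(y / 2))

lemma measurable_expHalf : Measurable expHalf := by unfold expHalf; fun_prop

lemma expHalf_pow (y : ℝ) (n : ℕ) : expHalf y ^ (2 * n) = Real.exp (-(n * y)) := by
  rw [expHalf, ← Real.exp_nat_mul]
  push_cast
  ring_nf

variable {h : ℕ → ℝ} {ρ : Measure ℝ}

/-- Tilting by e^(-ky) shifts the Laplace variable from n to k + n. -/
lemma IsLaplaceInverse.lintegral_tilt (L : IsLaplaceInverse ρ h) {k : ℕ} (hk : 1 ≤ k) (n : ℕ) :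
    ∫⁻ y, ENNReal.ofReal (Real.exp (-(n * y))) ∂(tilt ρ h k) =
      ENNReal.ofReal (h k / h (k + n)) := by
  rw [tilt, lintegral_withDensity_eq_lintegral_mul _ (by fun_prop) (by fun_prop)]
  have hp := L.slow.pos k hk
  have : ∀ y : ℝ, ((fun y => ENNReal.ofReal (h k * Real.exp (-(k * y)))) *
      fun y => ENNReal.ofReal (Real.exp (-(n * y)))) y =
      ENNReal.ofReal (h k) * ENNReal.ofReal (Real.exp (-((k + n : ℕ) * y))) := by
    intro y
    rw [Pi.mul_apply, ← ENNReal.ofReal_mul (by positivity), ← ENNReal.ofReal_mul hp.le, mul_assoc,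
      ← Real.exp_add]
    push_cast
    ring_nf
  simp_rw [this]
  rw [lintegral_const_mul _ (by fun_prop), L.laplace _ (by omega), ← ENNReal.ofReal_mul hp.le,
    div_eq_mul_inv]

lemma IsLaplaceInverse.isProbabilityMeasure_tilt (L : IsLaplaceInverse ρ h) {k : ℕ} (hk : 1 ≤ k) :
    IsProbabilityMeasure (tilt ρ h k) := by
  constructor
  have := L.lintegral_tilt hk 0
  simpa [div_self (L.slow.pos k hk).ne'] using this

lemma IsLaplaceInverse.ae_abs_expHalf (L : IsLaplaceInverse ρ h) (k : ℕ) :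
    ∀ᵐ y ∂(tilt ρ h k), |expHalf y| ≤ 1 := by
  refine (withDensity_absolutelyContinuous _ _).ae_le ?_
  filter_upwards [L.pos_ae] with y hy
  rw [expHalf, abs_of_pos (Real.exp_pos _), Real.exp_le_one_iff]
  linarith

lemma IsLaplaceInverse.integral_expHalf_pow (L : IsLaplaceInverse ρ h) {k : ℕ} (hk : 1 ≤ k)
    (n : ℕ) : ∫ y, expHalf y ^ (2 * n) ∂(tilt ρ h k) = h k / h (k + n) := by
  simp_rw [expHalf_pow]
  rw [integral_eq_lintegral_of_nonneg_ae (Eventually.of_forall fun y => (Real.exp_pos _).le)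
    (by fun_prop), L.lintegral_tilt hk, ENNReal.toReal_ofReal]
  exact (div_pos (L.slow.pos k hk) (L.slow.pos _ (by omega))).le

lemma shiftedProd_succ (h : ℕ → ℝ) (m n : ℕ) :
    shiftedProd h m (n + 1) = shiftedProd h m n * h (m + n + 1) := Finset.prod_range_succ _ _

lemma shiftedProd_add (h : ℕ → ℝ) (m n k : ℕ) :
    shiftedProd h m (n + k) = shiftedProd h m n * shiftedProd h (m + n) k := by
  simp only [shiftedProd, Finset.prod_range_add, add_assoc]

lemma shiftedProd_one (h : ℕ → ℝ) (m : ℕ) : shiftedProd h m 1 = h (m + 1) := by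
  simp [shiftedProd]

/-- Once v ≥ j, the index v + j + 1 is at most 2(v + 1), so monotonicity squeezes the ratio between
an inverse doubling ratio and 1. -/
lemma SlowlyIncreasing.tendsto_ratio (H : SlowlyIncreasing h) (j : ℕ) :
    Tendsto (fun v => h (v + 1) / h (v + j + 1)) atTop (𝓝 1) := by
  have h1 : Tendsto (fun v => (h (2 * (v + 1)) / h (v + 1))⁻¹) atTop (𝓝 1) := by
    have := (H.double.comp (tendsto_add_atTop_nat 1)).inv₀ one_ne_zero
    simpa using this
  refine tendsto_of_tendsto_of_tendsto_of_le_of_le' h1 tendsto_const_nhds ?_ ?_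
  · filter_upwards [eventually_ge_atTop j] with v hv
    rw [inv_div]
    have := H.pos (v + 1) (by omega)
    have := H.pos (v + j + 1) (by omega)
    have := H.mono (v + j + 1) (2 * (v + 1)) (by omega) (by omega)
    gcongr
  · filter_upwards with v
    exact (div_le_one (H.pos _ (by omega))).2 (H.mono _ _ (by omega) (by omega))

lemma SlowlyIncreasing.tendsto_pow_div_shiftedProd (H : SlowlyIncreasing h) (n : ℕ) :
    Tendsto (fun v => h (v + 1) ^ n / shiftedProd h v n) atTop (𝓝 1) := by
  have := tendsto_finsetProd (Finset.range n) fun j _ => H.tendsto_ratio j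
  simpa [Finset.prod_div_distrib, shiftedProd] using this

lemma SlowlyIncreasing.pow_le_shiftedProd (H : SlowlyIncreasing h) (v n : ℕ) :
    h (v + 1) ^ n ≤ shiftedProd h v n := by
  have : h (v + 1) ^ n = ∏ j ∈ Finset.range n, h (v + 1) := by simp
  rw [this]
  exact Finset.prod_le_prod (fun _ _ => (H.pos _ (by omega)).le)
    fun j _ => H.mono _ _ (by omega) (by omega)

/-- The law of the product of a random sign and of `N` independent tilted factors. -/
noncomputable def approxLaw (ρ : Measure ℝ) (h : ℕ → ℝ) (m : ℕ) : ℕ → Measure ℝ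
  | 0 => rademacher
  | N + 1 => mulLaw (tilt ρ h (m + N + 1)) expHalf (approxLaw ρ h m N)

lemma SlowlyIncreasing.evenSummable_div (H : SlowlyIncreasing h) (m N : ℕ) :
    EvenSummable fun n => shiftedProd h m n / shiftedProd h (m + N) n := by
  refine EvenSummable.mono (B := fun _ => 1) ?_ fun n => ?_
  · exact evenSummable_of_le_mul_factorial (C := 1) fun n => by
      simp only [abs_one, one_pow, one_mul]
      exact_mod_cast n.factorial_pos
  · rw [abs_of_pos (div_pos (shiftedProd_pos H _ _) (shiftedProd_pos H _ _))]
    refine (div_le_one (shiftedProd_pos H _ _)).2 ?_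
    exact Finset.prod_le_prod (fun _ _ => (H.pos _ (by omega)).le)
      fun j _ => H.mono _ _ (by omega) (by omega)

lemma IsLaplaceInverse.approxLaw_spec (L : IsLaplaceInverse ρ h) (m N : ℕ) :
    IsProbabilityMeasure (approxLaw ρ h m N) ∧
      ∀ t : ℝ, charFun (approxLaw ρ h m N) t =
        evenSeries (fun n => shiftedProd h m n / shiftedProd h (m + N) n) t := by
  induction N with
  | zero =>
    refine ⟨inferInstanceAs (IsProbabilityMeasure rademacher), fun t => ?_⟩
    simp only [approxLaw, add_zero, charFun_rademacher, div_self (shiftedProd_pos L.slow m _).ne']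
  | succ N ih =>
    obtain ⟨_, h1⟩ := ih
    have := L.isProbabilityMeasure_tilt (k := m + N + 1) (by omega)
    refine ⟨isProbabilityMeasure_mulLaw measurable_expHalf, fun t => ?_⟩
    rw [approxLaw, charFun_mulLaw measurable_expHalf (L.ae_abs_expHalf _)
      (L.slow.evenSummable_div m N) h1]
    congr 1
    ext n
    have h2 := shiftedProd_add h (m + N) 1 n
    rw [add_comm 1 n, shiftedProd_succ, shiftedProd_one] at h2
    have h3 := shiftedProd_pos L.slow (m + N) n
    have h4 := shiftedProd_pos L.slow (m + (N + 1)) n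
    have h5 := L.slow.pos (m + N + n + 1) (by omega)
    rw [L.integral_expHalf_pow (by omega), show m + N + 1 + n = m + N + n + 1 by ring]
    rw [show m + (N + 1) = m + N + 1 by ring] at h4 ⊢
    field_simp
    -- The new moment telescopes: both ways of splitting h(m+N+1)⋯h(m+N+n+1) agree.
    linear_combination -(shiftedProd h m n) * h2

lemma isProbabilityMeasure_map_const_mul (ν : Measure ℝ) [IsProbabilityMeasure ν] (c : ℝ) :
    IsProbabilityMeasure (ν.map (c * ·)) := Measure.isProbabilityMeasure_map (by fun_prop)

lemma charFun_map_const_mul_eq {ν : Measure ℝ} {b : ℕ → ℝ}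
    (hν : ∀ t : ℝ, charFun ν t = evenSeries b t) (c t : ℝ) :
    charFun (ν.map (c * ·)) t = evenSeries (fun n => c ^ (2 * n) * b n) t := by
  rw [charFun_map_mul, hν, Complex.ofReal_mul, evenSeries_mul]

/-- Rescaling by √h(m+N+1) turns the weights into b(n) times h(m+N+1)^n / (h(m+N+1)⋯h(m+N+n)). This
ratio is at most 1 and tends to 1, so b itself dominates. -/
lemma IsLaplaceInverse.exists_law (L : IsLaplaceInverse ρ h) (m : ℕ) :
    ∃ lam : Measure ℝ, IsProbabilityMeasure lam ∧
      ∀ t : ℝ, charFun lam t = evenSeries (shiftedProd h m) t := by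
  have hS := L.slow.evenSummable m
  refine exists_charFun_eq_of_tendsto
    (ν := fun N => (approxLaw ρ h m N).map (Real.sqrt (h (m + N + 1)) * ·)) (fun N => ?_) ?_ ?_
  · have := (L.approxLaw_spec m N).1
    exact isProbabilityMeasure_map_const_mul _ _
  · exact (hS.differentiable.continuous.comp Complex.continuous_ofReal).continuousAt
  · intro t
    simp_rw [charFun_map_const_mul_eq (L.approxLaw_spec m _).2]
    have key : ∀ N n, Real.sqrt (h (m + N + 1)) ^ (2 * n) *
        (shiftedProd h m n / shiftedProd h (m + N) n) =
        h (m + N + 1) ^ n / shiftedProd h (m + N) n * shiftedProd h m n := by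
      intro N n
      rw [pow_mul, Real.sq_sqrt (L.slow.pos _ (by omega)).le]
      ring
    simp_rw [key]
    refine tendsto_evenSeries hS (Eventually.of_forall fun N n => ?_) (fun n => ?_) _
    · have h1 := shiftedProd_pos L.slow (m + N) n
      have h2 := shiftedProd_pos L.slow m n
      have h3 := L.slow.pos (m + N + 1) (by omega)
      rw [abs_of_pos (by positivity)]
      exact mul_le_of_le_one_left h2.le ((div_le_one h1).2 (L.slow.pow_le_shiftedProd _ _))
    · have := ((L.slow.tendsto_pow_div_shiftedProd n).comp (tendsto_add_atTop_nat m)).mul_const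
        (shiftedProd h m n)
      simpa [Function.comp_def, add_comm] using this

/-- The law with characteristic function `evenSeries (shiftedProd h m)`. -/
noncomputable def IsLaplaceInverse.law (L : IsLaplaceInverse ρ h) (m : ℕ) : Measure ℝ :=
  (L.exists_law m).choose

instance (L : IsLaplaceInverse ρ h) (m : ℕ) : IsProbabilityMeasure (L.law m) :=
  (L.exists_law m).choose_spec.1

lemma IsLaplaceInverse.charFun_law (L : IsLaplaceInverse ρ h) (m : ℕ) (t : ℝ) :
    charFun (L.law m) t = evenSeries (shiftedProd h m) t :=
  (L.exists_law m).choose_spec.2 t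

lemma IsLaplaceInverse.law_eq_mulLaw (L : IsLaplaceInverse ρ h) (m : ℕ) :
    L.law m = mulLaw (tilt ρ h (m + 1)) expHalf (L.law (m + 1)) := by
  have := L.isProbabilityMeasure_tilt (k := m + 1) (by omega)
  have := isProbabilityMeasure_mulLaw (Q := tilt ρ h (m + 1)) measurable_expHalf
    (ν := L.law (m + 1))
  refine Measure.ext_of_charFun (funext fun t => ?_)
  rw [charFun_mulLaw measurable_expHalf (L.ae_abs_expHalf _) (L.slow.evenSummable (m + 1))
    (L.charFun_law (m + 1)), L.charFun_law]
  congr 1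
  ext n
  have h2 := shiftedProd_add h m 1 n
  rw [add_comm 1 n, shiftedProd_succ, shiftedProd_one] at h2
  have h5 := L.slow.pos (m + n + 1) (by omega)
  rw [L.integral_expHalf_pow (by omega), show m + 1 + n = m + n + 1 by ring]
  field_simp
  linarith

lemma IsLaplaceInverse.tendsto_rescaled_law (L : IsLaplaceInverse ρ h) :
    Tendsto (β := ProbabilityMeasure ℝ)
      (fun m => ⟨(L.law m).map ((Real.sqrt (h (m + 1)))⁻¹ * ·),
        isProbabilityMeasure_map_const_mul _ _⟩) atTop (𝓝 ⟨rademacher, inferInstance⟩) := by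
  refine ProbabilityMeasure.tendsto_of_tendsto_charFun fun t => ?_
  change Tendsto (fun m => charFun ((L.law m).map ((Real.sqrt (h (m + 1)))⁻¹ * ·)) t) atTop
    (𝓝 (charFun rademacher t))
  simp_rw [charFun_map_const_mul_eq (L.charFun_law _), charFun_rademacher]
  have key : ∀ m n, (Real.sqrt (h (m + 1)))⁻¹ ^ (2 * n) * shiftedProd h m n =
      (h (m + 1) ^ n / shiftedProd h m n)⁻¹ := by
    intro m n
    rw [pow_mul, inv_pow, Real.sq_sqrt (L.slow.pos _ (by omega)).le, inv_div, inv_pow]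
    ring
  simp_rw [key]
  obtain ⟨v₀, hv₀, hd⟩ := L.slow.le_rpow_mul one_pos
  -- The majorant is uniform in m: the Potter bound with exponent 1 gives h(m+j+1) ≤ 2(j+1)h(m+1),
  -- whose product over j < n is 2^n n! h(m+1)^n.
  refine tendsto_evenSeries (B := fun n => 2 ^ n * (n.factorial : ℝ)) ?_ ?_ (fun n => ?_) _
  · exact evenSummable_of_le_mul_factorial (C := 2) fun n => by rw [abs_of_pos (by positivity)]
  · filter_upwards [eventually_ge_atTop v₀] with m hm n
    have h3 := L.slow.pos (m + 1) (by omega)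
    rw [abs_of_pos (inv_pos.2 (div_pos (pow_pos h3 _) (shiftedProd_pos L.slow _ _))), inv_div,
      div_le_iff₀ (by positivity)]
    induction n with
    | zero => simp [shiftedProd]
    | succ n ih =>
      have h1 := hd (m + 1) (by omega) (n + 1) (by omega)
      rw [Real.rpow_one, Real.rpow_one] at h1
      have h2 := L.slow.mono (m + n + 1) ((n + 1) * (m + 1)) (by omega) (by nlinarith)
      have h4 := L.slow.pos (m + n + 1) (by omega)
      rw [shiftedProd_succ, Nat.factorial_succ]
      calc _ ≤ (2 ^ n * (n.factorial : ℝ) * h (m + 1) ^ n) * (2 * ((n + 1 : ℕ) : ℝ) * h (m + 1)) := by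
            gcongr
            exact h2.trans h1
        _ = _ := by push_cast; ring
  · simpa using (L.slow.tendsto_pow_div_shiftedProd n).inv₀ one_ne_zero

end VanDantzig

/-! ### Absolute continuity and full support -/

namespace VanDantzig

variable {h : ℕ → ℝ} {ρ : Measure ℝ}

lemma IsLaplaceInverse.law_singleton_zero_succ (L : IsLaplaceInverse ρ h) (m : ℕ) :
    L.law m {0} = L.law (m + 1) {0} := by
  have := L.isProbabilityMeasure_tilt (k := m + 1) (by omega)
  have hm := measurable_expHalf
  rw [L.law_eq_mulLaw, mulLaw, Measure.map_apply (by fun_prop) (measurableSet_singleton 0)]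
  have : (fun p : ℝ × ℝ => expHalf p.1 * p.2) ⁻¹' {0} = univ ×ˢ {0} := by
    ext p
    simp [expHalf, (Real.exp_pos _).ne']
  rw [this, Measure.prod_prod, measure_univ, one_mul]

/-- Nonzero factors and rescalings preserve the mass at 0, so it is the same for all m. By the
portmanteau theorem it is at most the mass at 0 of the limiting random sign. -/
lemma IsLaplaceInverse.law_singleton_zero (L : IsLaplaceInverse ρ h) (m : ℕ) :
    L.law m {0} = 0 := by
  have hconst : ∀ m, L.law m {0} = L.law 0 {0} := by
    intro m
    induction m with
    | zero => rfl
    | succ m ih => rw [← L.law_singleton_zero_succ, ih]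
  have h1 := ProbabilityMeasure.limsup_measure_closed_le_of_tendsto L.tendsto_rescaled_law
    (isClosed_singleton (x := (0 : ℝ)))
  have h2 : ∀ m, ((L.law m).map ((Real.sqrt (h (m + 1)))⁻¹ * ·)) {0} = L.law 0 {0} := by
    intro m
    rw [Measure.map_apply (by fun_prop) (measurableSet_singleton 0), ← hconst m]
    congr 1
    ext x
    have := Real.sqrt_pos.2 (L.slow.pos (m + 1) (by omega))
    simp [this.ne']
  have h3 : limsup (fun m => ((L.law m).map ((Real.sqrt (h (m + 1)))⁻¹ * ·)) {0}) atTop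
      ≤ rademacher {0} := h1
  simp_rw [h2] at h3
  rw [limsup_const] at h3
  rw [hconst, ← nonpos_iff_eq_zero]
  refine h3.trans (le_of_eq ?_)
  simp [rademacher]

/-- The set is covered by the image of A without 0 under the inverse map x ↦ -2 log(x/w), and
differentiable maps preserve null sets. -/
lemma volume_preimage_expHalf_mul {A : Set ℝ} (hA : volume A = 0) {w : ℝ} (hw : w ≠ 0) :
    volume {y | expHalf y * w ∈ A} = 0 := by
  have hd : DifferentiableOn ℝ (fun x => -2 * Real.log (x / w)) (A ∩ {0}ᶜ) := by
    intro x hx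
    have : x / w ≠ 0 := div_ne_zero hx.2 hw
    exact (by fun_prop (disch := assumption) :
      DifferentiableAt ℝ (fun x => -2 * Real.log (x / w)) x).differentiableWithinAt
  refine measure_mono_null (fun y hy => ?_)
    (addHaar_image_eq_zero_of_differentiableOn_of_addHaar_eq_zero volume hd
      (measure_mono_null inter_subset_left hA))
  refine ⟨expHalf y * w, ⟨hy, mul_ne_zero (Real.exp_pos _).ne' hw⟩, ?_⟩
  simp only [mul_div_cancel_right₀ _ hw, expHalf, Real.log_exp]
  ring

lemma mulLaw_expHalf_absolutelyContinuous {Q ν : Measure ℝ} [SFinite Q] [SFinite ν]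
    (hQ : Q ≪ volume) (hν : ν {0} = 0) : mulLaw Q expHalf ν ≪ volume := by
  have hm := measurable_expHalf
  refine Measure.AbsolutelyContinuous.mk fun A hA hA0 => ?_
  rw [mulLaw, Measure.map_apply (by fun_prop) hA,
    Measure.prod_apply_symm ((by fun_prop : Measurable fun p : ℝ × ℝ => expHalf p.1 * p.2) hA),
    lintegral_eq_zero_iff' ?_]
  · have : ∀ᵐ w ∂ν, w ≠ 0 := by
      rw [ae_iff]
      simpa using hν
    filter_upwards [this] with w hw
    exact hQ (volume_preimage_expHalf_mul hA0 hw)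
  · exact (measurable_measure_prodMk_right
      ((by fun_prop : Measurable fun p : ℝ × ℝ => expHalf p.1 * p.2) hA)).aemeasurable

lemma IsLaplaceInverse.law_absolutelyContinuous (L : IsLaplaceInverse ρ h) (hρ : ρ ≪ volume) :
    L.law 0 ≪ volume := by
  have := L.isProbabilityMeasure_tilt (k := 0 + 1) (by omega)
  rw [L.law_eq_mulLaw]
  exact mulLaw_expHalf_absolutelyContinuous ((withDensity_absolutelyContinuous _ _).trans hρ)
    (L.law_singleton_zero _)

lemma mul_mem_support_mulLaw {Q ν : Measure ℝ} [SFinite ν] {X : ℝ → ℝ} (hX : Continuous X)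
    {x y : ℝ} (hy : y ∈ Q.support) (hx : x ∈ ν.support) :
    X y * x ∈ (mulLaw Q X ν).support := by
  rw [Measure.mem_support_iff_forall] at *
  intro U hU
  have hc : Continuous fun p : ℝ × ℝ => X p.1 * p.2 := by fun_prop
  have hU' : (fun p : ℝ × ℝ => X p.1 * p.2) ⁻¹' U ∈ 𝓝 (y, x) := hc.continuousAt hU
  rw [nhds_prod_eq, mem_prod_iff] at hU'
  obtain ⟨V, hV, W, hW, hVW⟩ := hU'
  calc 0 < Q V * ν W := ENNReal.mul_pos (hy V hV).ne' (hx W hW).ne'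
    _ = (Q.prod ν) (V ×ˢ W) := (Measure.prod_prod _ _).symm
    _ ≤ (Q.prod ν) ((fun p : ℝ × ℝ => X p.1 * p.2) ⁻¹' U) := measure_mono hVW
    _ ≤ _ := Measure.le_map_apply hc.measurable.aemeasurable _

lemma IsLaplaceInverse.support_subset_support_tilt (L : IsLaplaceInverse ρ h) {k : ℕ} (hk : 1 ≤ k) :
    ρ.support ⊆ (tilt ρ h k).support := by
  refine Measure.AbsolutelyContinuous.support_mono ?_
  refine withDensity_absolutelyContinuous' (by fun_prop) (Eventually.of_forall fun y => ?_)
  have := L.slow.pos k hk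
  have : 0 < h k * Real.exp (-(k * y)) := by positivity
  simpa using this

lemma continuous_expHalf : Continuous expHalf := by unfold expHalf; fun_prop

/-- Each of the m factors can absorb up to R of the exponent y; the induction spends min(y, R) on
the outermost law and passes on the rest. -/
lemma IsLaplaceInverse.expHalf_mul_mem_support (L : IsLaplaceInverse ρ h) {R : ℝ}
    (hR : 0 < R) (hρ : ∀ y ∈ Icc 0 R, y ∈ ρ.support) (m : ℕ) :
    ∀ x y : ℝ, x ∈ (L.law m).support → 0 ≤ y → y ≤ m * R →
      expHalf y * x ∈ (L.law 0).support := by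
  induction m with
  | zero =>
    intro x y hx hy hy1
    have : y = 0 := le_antisymm (by simpa using hy1) hy
    simpa [this, expHalf] using hx
  | succ m ih =>
    intro x y hx hy hy1
    push_cast at hy1
    have h1 : expHalf (min y R) * x ∈ (L.law m).support := by
      rw [L.law_eq_mulLaw m]
      exact mul_mem_support_mulLaw continuous_expHalf
        (L.support_subset_support_tilt (by omega) (hρ _ ⟨le_min hy hR.le, min_le_right _ _⟩)) hx
    have h2 := ih _ (y - min y R) h1 (by simp) (by
      rcases le_total y R with hc | hc
      · rw [min_eq_left hc]
        have : (0 : ℝ) ≤ m * R := by positivity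
        linarith
      · rw [min_eq_right hc]
        linarith)
    rw [← mul_assoc] at h2
    have : expHalf (y - min y R) * expHalf (min y R) = expHalf y := by
      simp only [expHalf]
      rw [← Real.exp_add]
      ring_nf
    rwa [this] at h2

lemma IsLaplaceInverse.eventually_exists_mem_support (L : IsLaplaceInverse ρ h) {s : ℝ}
    (hs : s = 1 ∨ s = -1) : ∀ᶠ m in atTop, ∃ x : ℝ, s * x ∈ (L.law m).support ∧
      Real.sqrt (h (m + 1)) / 2 < x ∧ x < 2 * Real.sqrt (h (m + 1)) := by
  have hss : s * s = 1 := by rcases hs with rfl | rfl <;> norm_num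
  set O : Set ℝ := (s * ·) ⁻¹' Ioo (1 / 2) 2 with hO
  have hOo : IsOpen O := isOpen_Ioo.preimage (by fun_prop)
  have h1 : rademacher O ≤ liminf
      (fun m => ((L.law m).map ((Real.sqrt (h (m + 1)))⁻¹ * ·)) O) atTop :=
    ProbabilityMeasure.le_liminf_measure_open_of_tendsto L.tendsto_rescaled_law hOo
  have h2 : 0 < rademacher O := by
    rcases hs with rfl | rfl <;>
    · simp only [rademacher, Measure.smul_apply, Measure.add_apply,
        hO, smul_eq_mul]
      norm_num [indicator]
  filter_upwards [eventually_lt_of_lt_liminf (h2.trans_le h1)] with m hm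
  have hq := Real.sqrt_pos.2 (L.slow.pos (m + 1) (by omega))
  rw [Measure.map_apply (by fun_prop) hOo.measurableSet] at hm
  obtain ⟨x, hxO, hx⟩ := Measure.nonempty_inter_support_of_pos hm
  have hxO' : s * ((Real.sqrt (h (m + 1)))⁻¹ * x) ∈ Ioo (1 / 2 : ℝ) 2 := hxO
  refine ⟨s * x, by rwa [← mul_assoc, hss, one_mul], ?_⟩
  have e : s * ((Real.sqrt (h (m + 1)))⁻¹ * x) = (s * x) / Real.sqrt (h (m + 1)) := by
    field_simp
  rw [e] at hxO'
  have h3 := (lt_div_iff₀ hq).1 hxO'.1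
  have h4 := (div_lt_iff₀ hq).1 hxO'.2
  constructor <;> linarith

lemma IsLaplaceInverse.support_law (L : IsLaplaceInverse ρ h) (htop : Tendsto h atTop atTop)
    {R : ℝ} (hR : 0 < R) (hρ : ∀ y ∈ Ioo 0 R, y ∈ ρ.support) : (L.law 0).support = univ := by
  have hρ' : ∀ y ∈ Icc 0 R, y ∈ ρ.support := by
    intro y hy
    rw [← closure_Ioo hR.ne] at hy
    exact closure_minimal hρ Measure.isClosed_support hy
  obtain ⟨C, hC, hCh⟩ := L.slow.le_const_mul_rpow one_pos
  have key : ∀ s : ℝ, s = 1 ∨ s = -1 → ∀ p : ℝ, 0 < p → s * p ∈ (L.law 0).support := by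
    intro s hs p hp
    -- The constant p/(4C) matches x < 2√h(m+1) ≤ 2h(m+1) ≤ 2C(m+1) ≤ 4Cm, so that x ≤ p e^(Rm/2).
    have hexp := ((isLittleO_pow_exp_pos_mul_atTop 1 (half_pos hR)).comp_tendsto
      tendsto_natCast_atTop_atTop).bound (show 0 < p / (4 * C) by positivity)
    have ht1 : Tendsto (fun m => h (m + 1)) atTop atTop := htop.comp (tendsto_add_atTop_nat 1)
    obtain ⟨m, ⟨x, hx, hx1, hx2⟩, h1, h2, h3, h4⟩ :=
      ((L.eventually_exists_mem_support hs).and (hexp.and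
        ((eventually_ge_atTop 1).and ((ht1.eventually_ge_atTop 1).and
          (ht1.eventually_ge_atTop ((2 * p) ^ 2)))))).exists
    have h5 : 2 * p ≤ Real.sqrt (h (m + 1)) := Real.le_sqrt_of_sq_le h4
    have h6 : Real.sqrt (h (m + 1)) ≤ h (m + 1) := by
      rw [Real.sqrt_le_left (by linarith)]
      nlinarith
    have h7 := hCh (m + 1) (by omega)
    rw [Real.rpow_one] at h7
    have hm1 : (1 : ℝ) ≤ m := by exact_mod_cast h2
    simp only [Function.comp_apply, pow_one, Real.norm_eq_abs, Real.abs_exp, Nat.abs_cast] at h1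
    have hpx : p ≤ x := by linarith
    have hx0 : 0 < x := hp.trans_le hpx
    have h8 : x ≤ p * Real.exp (R / 2 * m) := by
      push_cast at h7
      have h9 : (4 * C) * m ≤ p * Real.exp (R / 2 * m) := by
        rw [div_mul_eq_mul_div, le_div_iff₀ (by positivity)] at h1
        linarith
      nlinarith
    -- This exponent shrinks x exactly to p; it is nonnegative since p ≤ x and at most mR by the
    -- exponential bound.
    have h10 := L.expHalf_mul_mem_support hR hρ' m (s * x) (2 * Real.log (x / p)) hx
      (mul_nonneg zero_le_two (Real.log_nonneg ((one_le_div hp).2 hpx))) (by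
        have : Real.log (x / p) ≤ R / 2 * m := by
          rw [Real.log_le_iff_le_exp (by positivity), div_le_iff₀ hp]
          linarith
        linarith)
    have h11 : expHalf (2 * Real.log (x / p)) = p / x := by
      rw [expHalf, mul_div_cancel_left₀ _ two_ne_zero, Real.exp_neg, Real.exp_log (by positivity),
        inv_div]
    rw [h11] at h10
    convert h10 using 1
    field_simp
  have hdense : Dense ({0}ᶜ : Set ℝ) := dense_compl_singleton 0
  refine eq_univ_of_univ_subset ?_
  rw [← hdense.closure_eq]
  refine closure_minimal (fun x hx => ?_) Measure.isClosed_support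
  rcases lt_or_gt_of_ne (show x ≠ 0 from hx) with h0 | h0
  · simpa using key (-1) (Or.inr rfl) (-x) (by linarith)
  · simpa using key 1 (Or.inl rfl) x h0

end VanDantzig

/-! ### Laplace representation of the Lévy–Khintchine exponent -/

namespace VanDantzig

/-- The compensated integrand of the Lévy–Khintchine formula. -/
noncomputable def lkIntegrand (u r : ℝ) : ℝ :=
  1 - Real.exp (-(u * r)) - (Iio (1 : ℝ)).indicator (fun s => u * s) r

lemma measurable_lkIntegrand (u : ℝ) : Measurable (lkIntegrand u) := by
  unfold lkIntegrand
  exact Measurable.sub (by fun_prop) (Measurable.indicator (by fun_prop) measurableSet_Iio)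

lemma abs_lkIntegrand_le {u U r : ℝ} (hu : 0 ≤ u) (hU : u ≤ U) (hr : 0 < r) :
    |lkIntegrand u r| ≤ (1 + U ^ 2) * min 1 (r ^ 2) := by
  have hur : 0 ≤ u * r := by positivity
  have h1 := Real.add_one_le_exp (-(u * r))
  have h2 : Real.exp (-(u * r)) ≤ 1 := Real.exp_le_one_iff.2 (by linarith)
  have h3 := Real.exp_pos (-(u * r))
  have hsq : u ^ 2 ≤ U ^ 2 := by gcongr
  unfold lkIntegrand
  by_cases h : r < 1
  · rw [indicator_of_mem (show r ∈ Iio 1 from h), min_eq_right (by nlinarith)]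
    have h4 : Real.exp (-(u * r)) ≤ 1 - u * r + (u * r) ^ 2 := by
      have h5 := Real.add_one_le_exp (u * r)
      have h6 : Real.exp (-(u * r)) * Real.exp (u * r) = 1 := by rw [← Real.exp_add]; simp
      by_cases hx : u * r ≤ 1
      · nlinarith [mul_nonneg hur (sq_nonneg (u * r))]
      · nlinarith
    have h7 : (u * r) ^ 2 ≤ (1 + U ^ 2) * r ^ 2 := by
      rw [mul_pow]
      nlinarith [sq_nonneg r]
    rw [abs_le]
    constructor <;> linarith
  · rw [indicator_of_notMem (show r ∉ Iio 1 from h), sub_zero, min_eq_left (by nlinarith),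
      abs_of_nonneg (by linarith)]
    nlinarith [sq_nonneg U]

variable {ν : Measure ℝ}

/-- A Lévy measure on `(0, ∞)`. -/
structure IsLevyMeasure (ν : Measure ℝ) : Prop where
  pos_ae : ∀ᵐ r ∂ν, 0 < r
  lintegral_lt_top : (∫⁻ r, ENNReal.ofReal (min 1 (r ^ 2)) ∂ν) < ⊤

lemma IsLevyMeasure.integrable_min (hν : IsLevyMeasure ν) :
    Integrable (fun r : ℝ => min 1 (r ^ 2)) ν := by
  refine ⟨by fun_prop, ?_⟩
  rw [hasFiniteIntegral_iff_ofReal (Eventually.of_forall fun r => by positivity)]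
  exact hν.lintegral_lt_top

lemma IsLevyMeasure.integrable_lkIntegrand (hν : IsLevyMeasure ν) {u : ℝ} (hu : 0 ≤ u) :
    Integrable (lkIntegrand u) ν := by
  refine (hν.integrable_min.const_mul (1 + u ^ 2)).mono'
    (measurable_lkIntegrand u).aestronglyMeasurable ?_
  filter_upwards [hν.pos_ae] with r hr
  exact abs_lkIntegrand_le hu le_rfl hr

/-- Weighting by min(1, r²), positive almost everywhere, gives a finite measure; undoing the weight
recovers ν. Tonelli's theorem needs this. -/
lemma IsLevyMeasure.sFinite (hν : IsLevyMeasure ν) : SFinite ν := by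
  have hm : Measurable fun r : ℝ => ENNReal.ofReal (min 1 (r ^ 2)) := by fun_prop
  have : IsFiniteMeasure (ν.withDensity fun r : ℝ => ENNReal.ofReal (min 1 (r ^ 2))) :=
    isFiniteMeasure_withDensity hν.lintegral_lt_top.ne
  rw [← withDensity_inv_same (μ := ν) hm ?_ (Eventually.of_forall fun r => ENNReal.ofReal_ne_top)]
  · infer_instance
  · filter_upwards [hν.pos_ae] with r hr
    have : (0 : ℝ) < min 1 (r ^ 2) := by positivity
    simpa using hr.ne'

lemma IsLevyMeasure.continuousAt_integral (hν : IsLevyMeasure ν) {u : ℝ} (hu : 0 < u) :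
    ContinuousAt (fun v => ∫ r, lkIntegrand v r ∂ν) u := by
  refine continuousAt_of_dominated (bound := fun r => (1 + (u + 1) ^ 2) * min 1 (r ^ 2))
    (Eventually.of_forall fun v => (measurable_lkIntegrand v).aestronglyMeasurable) ?_
    (hν.integrable_min.const_mul _) (Eventually.of_forall fun r => ?_)
  · filter_upwards [Ioo_mem_nhds hu (lt_add_one u)] with v hv
    filter_upwards [hν.pos_ae] with r hr
    exact abs_lkIntegrand_le hv.1.le hv.2.le hr
  · unfold lkIntegrand
    by_cases h : r ∈ Iio (1 : ℝ)
    · simp only [indicator_of_mem h]; fun_prop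
    · simp only [indicator_of_notMem h]; fun_prop

/-- The compensator is linear in u, so it cancels in 2u·f(1/2) - f(u), where f(u) is the integrand
at r. What remains is an explicit exponential primitive. -/
lemma integral_exp_mul_one_sub_exp {u : ℝ} (hu : 1 / 2 < u) (r : ℝ) :
    ∫ y in (0 : ℝ)..r, Real.exp (-(u * y)) * (1 - Real.exp (-((r - y) / 2))) =
      (2 * u * lkIntegrand (1 / 2) r - lkIntegrand u r) / (u * (2 * u - 1)) := by
  have hu0 : u ≠ 0 := by linarith
  have hu1 : 2 * u - 1 ≠ 0 := by linarith
  have hd : ∀ y ∈ uIcc 0 r, HasDerivAt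
      (fun y => -Real.exp (-(u * y)) / u +
        2 * Real.exp (-(r / 2)) * Real.exp (-((u - 1 / 2) * y)) / (2 * u - 1))
      (Real.exp (-(u * y)) * (1 - Real.exp (-((r - y) / 2)))) y := by
    intro y _
    have h1 : HasDerivAt (fun y => Real.exp (-(u * y))) (Real.exp (-(u * y)) * (-(u * 1))) y :=
      (((hasDerivAt_id y).const_mul u).neg).exp
    have h2 : HasDerivAt (fun y => Real.exp (-((u - 1 / 2) * y)))
        (Real.exp (-((u - 1 / 2) * y)) * (-((u - 1 / 2) * 1))) y :=
      (((hasDerivAt_id y).const_mul (u - 1 / 2)).neg).exp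
    refine ((h1.neg.div_const u).add
      ((h2.const_mul (2 * Real.exp (-(r / 2)))).div_const (2 * u - 1))).congr_deriv ?_
    have h3 : Real.exp (-(u * y)) * Real.exp (-((r - y) / 2)) =
        Real.exp (-(r / 2)) * Real.exp (-((u - 1 / 2) * y)) := by
      rw [← Real.exp_add, ← Real.exp_add]
      ring_nf
    rw [mul_sub, mul_one, h3]
    generalize Real.exp (-((u - 1 / 2) * y)) = B
    rw [show u - 1 / 2 = (2 * u - 1) / 2 by ring]
    generalize 2 * u - 1 = d at hu1 ⊢
    field_simp
    ring
  rw [intervalIntegral.integral_eq_sub_of_hasDerivAt hd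
    (Continuous.intervalIntegrable (by fun_prop) _ _)]
  have h4 : Real.exp (-(r / 2)) * Real.exp (-((u - 1 / 2) * r)) = Real.exp (-(u * r)) := by
    rw [← Real.exp_add]
    ring_nf
  rw [mul_assoc 2, h4]
  have h5 : (Iio (1 : ℝ)).indicator (fun s => u * s) r =
      2 * u * (Iio (1 : ℝ)).indicator (fun s => 1 / 2 * s) r := by
    by_cases h : r ∈ Iio (1 : ℝ)
    · simp only [indicator_of_mem h]; ring
    · simp only [indicator_of_notMem h]; ring
  simp only [lkIntegrand, h5, mul_zero, neg_zero, Real.exp_zero]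
  rw [show (1 / 2 * r) = r / 2 by ring]
  generalize Real.exp (-(r / 2)) = A
  generalize Real.exp (-(u * r)) = B
  generalize (Iio (1 : ℝ)).indicator (fun s => 1 / 2 * s) r = D
  generalize hd : 2 * u - 1 = d at hu1 ⊢
  field_simp
  linear_combination (B - 1) * hd

/-- `ENNReal.ofReal` vanishes on the negative values at y > r, which truncates the half-line
integral to (0, r]. -/
lemma lintegral_exp_mul_one_sub_exp {u : ℝ} (hu : 1 / 2 < u) {r : ℝ} (hr : 0 < r) :
    ∫⁻ y in Ioi (0 : ℝ), ENNReal.ofReal (Real.exp (-(u * y))) *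
        ENNReal.ofReal (1 - Real.exp (-((r - y) / 2))) =
      ENNReal.ofReal ((2 * u * lkIntegrand (1 / 2) r - lkIntegrand u r) / (u * (2 * u - 1))) ∧
    0 ≤ (2 * u * lkIntegrand (1 / 2) r - lkIntegrand u r) / (u * (2 * u - 1)) := by
  have hnn : ∀ y ∈ Ioc 0 r, 0 ≤ Real.exp (-(u * y)) * (1 - Real.exp (-((r - y) / 2))) := by
    intro y hy
    have : Real.exp (-((r - y) / 2)) ≤ 1 := Real.exp_le_one_iff.2 (by linarith [hy.2])
    exact mul_nonneg (Real.exp_pos _).le (by linarith)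
  rw [← integral_exp_mul_one_sub_exp hu, intervalIntegral.integral_of_le hr.le]
  refine ⟨?_, setIntegral_nonneg measurableSet_Ioc hnn⟩
  rw [ofReal_integral_eq_lintegral_ofReal
    (Continuous.integrableOn_Ioc (by fun_prop))
    ((ae_restrict_iff' measurableSet_Ioc).2 (Eventually.of_forall hnn))]
  simp_rw [← ENNReal.ofReal_mul (Real.exp_pos _).le]
  rw [← Ioc_union_Ioi_eq_Ioi hr.le, lintegral_union measurableSet_Ioi
    (Set.Ioc_disjoint_Ioi le_rfl)]
  rw [setLIntegral_congr_fun (s := Ioi r) (g := fun _ => 0) measurableSet_Ioi]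
  · simp
  · intro y hy
    have : 1 ≤ Real.exp (-((r - y) / 2)) := Real.one_le_exp (by
      have : r < y := hy
      linarith)
    exact ENNReal.ofReal_of_nonpos (mul_nonpos_of_nonneg_of_nonpos (Real.exp_pos _).le (by linarith))

lemma lintegral_Ioi_exp_neg {u : ℝ} (hu : 0 < u) :
    ∫⁻ y in Ioi (0 : ℝ), ENNReal.ofReal (Real.exp (-(u * y))) = ENNReal.ofReal (1 / u) := by
  have h1 := integrableOn_exp_mul_Ioi (a := -u) (by linarith) 0
  have h2 := integral_exp_mul_Ioi (a := -u) (by linarith) 0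
  simp only [neg_mul, mul_zero, Real.exp_zero, neg_div_neg_eq] at h1 h2
  rw [← h2, ofReal_integral_eq_lintegral_ofReal h1 (Eventually.of_forall fun y => (Real.exp_pos _).le)]

/-- The density whose Laplace transform is `Ψ(u) / (2 u (2 u - 1)) - σ² / 8`, with `p = Ψ(1/2)`. -/
noncomputable def lkDensity (p κ : ℝ) (ν : Measure ℝ) (y : ℝ) : ENNReal :=
  ENNReal.ofReal (p / 2 * Real.exp (y / 2) + κ / 2) +
    ENNReal.ofReal (1 / 2) * ∫⁻ r, ENNReal.ofReal (1 - Real.exp (-((r - y) / 2))) ∂ν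

lemma measurable_lkDensity (p κ : ℝ) [SFinite ν] : Measurable (lkDensity p κ ν) := by
  unfold lkDensity
  have h1 : Measurable fun y => ENNReal.ofReal (p / 2 * Real.exp (y / 2) + κ / 2) := by fun_prop
  refine h1.add (Measurable.const_mul ?_ _)
  exact Measurable.lintegral_prod_right' (ν := ν)
    (f := fun q : ℝ × ℝ => ENNReal.ofReal (1 - Real.exp (-((q.2 - q.1) / 2)))) (by fun_prop)

lemma IsLevyMeasure.lintegral_lkDensity (hν : IsLevyMeasure ν) {p κ : ℝ} (hp : 0 ≤ p) (hκ : 0 ≤ κ)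
    {u : ℝ} (hu : 1 / 2 < u) :
    ∫⁻ y in Ioi (0 : ℝ), ENNReal.ofReal (Real.exp (-(u * y))) * lkDensity p κ ν y =
      ENNReal.ofReal (p / (2 * u - 1) + κ / (2 * u) +
        (2 * u * (∫ r, lkIntegrand (1 / 2) r ∂ν) - ∫ r, lkIntegrand u r ∂ν) /
          (2 * u * (2 * u - 1))) ∧
    0 ≤ (2 * u * (∫ r, lkIntegrand (1 / 2) r ∂ν) - ∫ r, lkIntegrand u r ∂ν) /
          (2 * u * (2 * u - 1)) := by
  have hu0 : 0 < u := by linarith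
  have hu1 : 0 < 2 * u - 1 := by linarith
  have := hν.sFinite
  have hI := hν.integrable_lkIntegrand hu0.le
  have hI2 := hν.integrable_lkIntegrand (u := 1 / 2) (by norm_num)
  set K : ℝ → ℝ := fun r =>
    (2 * u * lkIntegrand (1 / 2) r - lkIntegrand u r) / (u * (2 * u - 1)) with hK
  have hKi : Integrable K ν := ((hI2.const_mul (2 * u)).sub hI).div_const _
  have hKnn : 0 ≤ᵐ[ν] K := by
    filter_upwards [hν.pos_ae] with r hr
    exact (lintegral_exp_mul_one_sub_exp hu hr).2
  have hKint : ∫ r, K r ∂ν = (2 * u * (∫ r, lkIntegrand (1 / 2) r ∂ν) - ∫ r, lkIntegrand u r ∂ν) /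
      (u * (2 * u - 1)) := by
    rw [hK, integral_div, integral_sub (hI2.const_mul _) hI, integral_const_mul]
  have hhalf : (2 * u * (∫ r, lkIntegrand (1 / 2) r ∂ν) - ∫ r, lkIntegrand u r ∂ν) /
          (2 * u * (2 * u - 1)) = 1 / 2 * ∫ r, K r ∂ν := by
    rw [hKint]
    field_simp
  have hKI0 : 0 ≤ ∫ r, K r ∂ν := integral_nonneg_of_ae hKnn
  rw [hhalf]
  refine ⟨?_, by positivity⟩
  have hA : ∫⁻ y in Ioi (0 : ℝ), ENNReal.ofReal (Real.exp (-(u * y))) *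
      ENNReal.ofReal (p / 2 * Real.exp (y / 2) + κ / 2) =
      ENNReal.ofReal (p / (2 * u - 1) + κ / (2 * u)) := by
    have : ∀ y : ℝ, ENNReal.ofReal (Real.exp (-(u * y))) *
        ENNReal.ofReal (p / 2 * Real.exp (y / 2) + κ / 2) =
        ENNReal.ofReal (p / 2) * ENNReal.ofReal (Real.exp (-((u - 1 / 2) * y))) +
        ENNReal.ofReal (κ / 2) * ENNReal.ofReal (Real.exp (-(u * y))) := by
      intro y
      rw [← ENNReal.ofReal_mul (by positivity), ← ENNReal.ofReal_mul (by positivity),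
        ← ENNReal.ofReal_mul (by positivity), ← ENNReal.ofReal_add (by positivity) (by positivity),
        show Real.exp (-((u - 1 / 2) * y)) = Real.exp (-(u * y)) * Real.exp (y / 2) by
          rw [← Real.exp_add]; ring_nf]
      ring_nf
    simp_rw [this]
    rw [lintegral_add_left (by fun_prop), lintegral_const_mul _ (by fun_prop),
      lintegral_const_mul _ (by fun_prop), lintegral_Ioi_exp_neg hu0,
      lintegral_Ioi_exp_neg (by linarith), ← ENNReal.ofReal_mul (by positivity),
      ← ENNReal.ofReal_mul (by positivity), ← ENNReal.ofReal_add ?_ (by positivity)]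
    · congr 1
      have : u - 1 / 2 = (2 * u - 1) / 2 := by ring
      rw [this]
      field_simp
    · have : 0 < u - 1 / 2 := by linarith
      positivity
  have hB : ∫⁻ y in Ioi (0 : ℝ), ENNReal.ofReal (Real.exp (-(u * y))) *
      ∫⁻ r, ENNReal.ofReal (1 - Real.exp (-((r - y) / 2))) ∂ν = ENNReal.ofReal (∫ r, K r ∂ν) := by
    simp_rw [← lintegral_const_mul' _ _ ENNReal.ofReal_ne_top]
    rw [lintegral_lintegral_swap (Measurable.aemeasurable (by unfold Function.uncurry; fun_prop)),
      ofReal_integral_eq_lintegral_ofReal hKi hKnn]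
    refine lintegral_congr_ae ?_
    filter_upwards [hν.pos_ae] with r hr
    exact (lintegral_exp_mul_one_sub_exp hu hr).1
  simp only [lkDensity, mul_add]
  rw [lintegral_add_left (by fun_prop), hA,
    ENNReal.ofReal_add (p := p / (2 * u - 1) + κ / (2 * u)) (by positivity) (by positivity),
    ENNReal.ofReal_mul (p := 1 / 2) (by norm_num), ← hB, ← lintegral_const_mul' _ _ ENNReal.ofReal_ne_top]
  simp_rw [mul_left_comm]

/-- The exponential part vanishes somewhere only if p = κ = 0, hence everywhere, and the Lévy part
decreases in y. So nonvanishing at one point propagates to the left. -/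
lemma lkDensity_pos_of_le {p κ : ℝ} (hp : 0 ≤ p) (hκ : 0 ≤ κ) {y y₀ : ℝ} (hy : y ≤ y₀)
    (h : lkDensity p κ ν y₀ ≠ 0) : lkDensity p κ ν y ≠ 0 := by
  unfold lkDensity at *
  intro h0
  rw [add_eq_zero] at h0
  refine h (add_eq_zero.2 ⟨?_, ?_⟩)
  · have h1 := ENNReal.ofReal_eq_zero.1 h0.1
    have h2 := Real.exp_pos (y / 2)
    have h3 : p = 0 := by nlinarith [mul_nonneg hp h2.le]
    have h4 : κ = 0 := by nlinarith [mul_nonneg hp h2.le]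
    simp [h3, h4]
  · rw [← nonpos_iff_eq_zero, ← h0.2]
    gcongr

end VanDantzig

/-! ### The ratio sequence of Ψ and its Laplace measure -/

namespace VanDantzig

/-- The sequence `2 k (2 k - 1) / Ψ(k)`. -/
noncomputable def coeffRatio (Ψ : ℝ → ℝ) (k : ℕ) : ℝ := 2 * k * (2 * k - 1) / Ψ k

lemma shiftedProd_coeffRatio_div (Ψ : ℝ → ℝ) (n : ℕ) :
    shiftedProd (coeffRatio Ψ) 0 n / ((2 * n).factorial : ℝ) =
      (∏ k ∈ Finset.Icc 1 n, Ψ (k : ℝ))⁻¹ := by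
  induction n with
  | zero => simp [shiftedProd]
  | succ n ih =>
    rw [shiftedProd_succ, Finset.prod_Icc_succ_top (by omega), mul_inv, ← ih,
      show 2 * (n + 1) = 2 * n + 1 + 1 by ring, Nat.factorial_succ, Nat.factorial_succ, coeffRatio,
      zero_add]
    push_cast
    have : (0 : ℝ) < (2 * n).factorial := by positivity
    field_simp
    ring

lemma seriesTerm_eq (Ψ : ℝ → ℝ) (z : ℂ) (n : ℕ) :
    seriesTerm Ψ z n = (((-1) ^ n * shiftedProd (coeffRatio Ψ) 0 n / ((2 * n).factorial : ℝ) : ℝ) : ℂ)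
      * z ^ (2 * n) := by
  rw [seriesTerm, mul_div_assoc, shiftedProd_coeffRatio_div]
  push_cast
  rw [div_eq_mul_inv]

lemma J_eq_evenSeries (Ψ : ℝ → ℝ) : J Ψ = evenSeries (shiftedProd (coeffRatio Ψ) 0) :=
  funext fun z => tsum_congr (seriesTerm_eq Ψ z)

section

variable {Ψ l : ℝ → ℝ}

lemma eventually_pos_of_eq_sq_div (hl : Tendsto l atTop atTop)
    (hΨ : ∀ᶠ u : ℝ in atTop, Ψ u = u ^ 2 / l u) : ∀ᶠ u : ℝ in atTop, 0 < Ψ u := by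
  filter_upwards [hΨ, hl.eventually_gt_atTop 0, eventually_gt_atTop 0] with u h1 h2 h3
  rw [h1]
  positivity

lemma pos_of_largestZero_lt (hev : ∀ᶠ u : ℝ in atTop, 0 < Ψ u)
    (hcont : ∀ u, 0 < u → ContinuousAt Ψ u) {u : ℝ} (hu0 : 0 < u) (hu : largestZero Ψ < u) :
    0 < Ψ u := by
  obtain ⟨U, hU⟩ := eventually_atTop.1 hev
  have hbdd : BddAbove {u : ℝ | 0 ≤ u ∧ Ψ u = 0} := by
    refine ⟨U, fun v hv => ?_⟩
    by_contra hc
    exact (hU v (not_le.1 hc).le).ne' hv.2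
  by_contra hc
  have hmem : (0 : ℝ) ∈ Icc (Ψ u) (Ψ (max u U)) := ⟨not_lt.1 hc, (hU _ (le_max_right _ _)).le⟩
  obtain ⟨v, hv, hv0⟩ := intermediate_value_Icc (le_max_left u U)
    (fun v hv => (hcont v (hu0.trans_le hv.1)).continuousWithinAt) hmem
  have := le_csSup hbdd (show v ∈ {u : ℝ | 0 ≤ u ∧ Ψ u = 0} from ⟨(hu0.trans_le hv.1).le, hv0⟩)
  exact absurd (this.trans_lt hu) (not_lt.2 hv.1)

lemma tendsto_coeffRatio_atTop (hl : Tendsto l atTop atTop)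
    (hΨ : ∀ᶠ u : ℝ in atTop, Ψ u = u ^ 2 / l u) : Tendsto (coeffRatio Ψ) atTop atTop := by
  refine tendsto_atTop_mono' _ ?_ (hl.comp tendsto_natCast_atTop_atTop)
  filter_upwards [tendsto_natCast_atTop_atTop.eventually hΨ,
    (hl.comp tendsto_natCast_atTop_atTop).eventually_gt_atTop 0, eventually_ge_atTop 1]
    with k h1 h2 h3
  have hk : (1 : ℝ) ≤ k := by exact_mod_cast h3
  simp only [Function.comp_apply] at h2 ⊢
  rw [coeffRatio, h1, div_div_eq_mul_div, le_div_iff₀ (by positivity),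
    mul_comm (l k)]
  gcongr
  nlinarith

lemma tendsto_coeffRatio_double (hl : IsSlowlyVarying l) (hlt : Tendsto l atTop atTop)
    (hΨ : ∀ᶠ u : ℝ in atTop, Ψ u = u ^ 2 / l u) :
    Tendsto (fun k => coeffRatio Ψ (2 * k) / coeffRatio Ψ k) atTop (𝓝 1) := by
  have hN := tendsto_natCast_atTop_atTop (R := ℝ)
  have hN2 : Tendsto (fun k : ℕ => 2 * (k : ℝ)) atTop atTop := hN.const_mul_atTop two_pos
  have h1 : Tendsto (fun k : ℕ => l (2 * k) / l k) atTop (𝓝 1) := (hl.2 2 two_pos).comp hN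
  have h2 : Tendsto (fun k : ℕ => (k : ℝ)⁻¹) atTop (𝓝 0) := tendsto_inv_atTop_zero.comp hN
  have h3 : Tendsto (fun k : ℕ => (4 - (k : ℝ)⁻¹) / (4 - 2 * (k : ℝ)⁻¹) * (l (2 * k) / l k)) atTop
      (𝓝 ((4 - 0) / (4 - 2 * 0) * 1)) :=
    ((h2.const_sub 4).div ((h2.const_mul 2).const_sub 4) (by norm_num)).mul h1
  have h4 : ((4 : ℝ) - 0) / (4 - 2 * 0) * 1 = 1 := by norm_num
  rw [h4] at h3
  refine h3.congr' ?_
  filter_upwards [hN.eventually hΨ, hN2.eventually hΨ, eventually_ge_atTop 1,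
    (hlt.comp hN).eventually_gt_atTop 0, (hlt.comp hN2).eventually_gt_atTop 0]
    with k e1 e2 hk e3 e4
  have hk : (1 : ℝ) ≤ k := by exact_mod_cast hk
  simp only [Function.comp_apply] at e3 e4
  have h5 : 4 - 2 * (k : ℝ)⁻¹ = 2 * (2 * k - 1) / k := by field_simp; ring
  have h6 : 4 - (k : ℝ)⁻¹ = (4 * k - 1) / k := by field_simp
  have h7 : 0 < 2 * (k : ℝ) - 1 := by linarith
  rw [coeffRatio, coeffRatio, h5, h6]
  push_cast
  rw [e1, e2]
  generalize 2 * (k : ℝ) - 1 = d at h7 ⊢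
  field_simp
  ring

lemma mem_support_withDensity_restrict {g : ℝ → ENNReal} (hg : Measurable g) {R : ℝ}
    (hpos : ∀ y ∈ Ioo 0 R, g y ≠ 0) {y : ℝ} (hy : y ∈ Ioo 0 R) :
    y ∈ ((volume.restrict (Ioi 0)).withDensity g).support := by
  have h1 : y ∈ (volume.restrict (Ioo (0 : ℝ) R)).support := by
    refine Measure.interior_inter_support ⟨by rwa [interior_Ioo], ?_⟩
    rw [Measure.support_eq_univ]
    trivial
  refine Measure.AbsolutelyContinuous.support_mono ?_ h1
  refine (withDensity_absolutelyContinuous' hg.aemeasurable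
    ((ae_restrict_iff' measurableSet_Ioo).2 (Eventually.of_forall hpos))).trans ?_
  refine Measure.absolutelyContinuous_of_le ?_
  rw [show (Ioo (0 : ℝ) R) = Ioo 0 R ∩ Ioi 0 from
    (inter_eq_left.2 fun _ h => h.1).symm, ← Measure.restrict_restrict measurableSet_Ioo,
    ← restrict_withDensity measurableSet_Ioo]
  exact Measure.restrict_le_self

lemma exists_isLaplaceInverse_coeffRatio (hΨ : MemND Ψ) (hl : IsSlowlyVarying l)
    (hlt : Tendsto l atTop atTop) (hΨl : ∀ᶠ u : ℝ in atTop, Ψ u = u ^ 2 / l u) :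
    ∃ ρ : Measure ℝ, IsLaplaceInverse ρ (coeffRatio Ψ) ∧ ρ ≪ volume ∧
      ∃ R, 0 < R ∧ ∀ y ∈ Ioo 0 R, y ∈ ρ.support := by
  obtain ⟨⟨κ, a, σ, μ, hκ, hμ, -, hΨe⟩, -, hθ⟩ := hΨ
  set ν := μ.restrict (Ioi 0) with hν_def
  have hν : IsLevyMeasure ν := ⟨ae_restrict_mem measurableSet_Ioi, hμ⟩
  have := hν.sFinite
  have hform : ∀ u, 0 ≤ u → Ψ u = -κ + a * u + σ ^ 2 / 2 * u ^ 2 - ∫ r, lkIntegrand u r ∂ν := hΨe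
  have hcont : ∀ u, 0 < u → ContinuousAt Ψ u := by
    intro u hu
    have h1 : ContinuousAt (fun u => -κ + a * u + σ ^ 2 / 2 * u ^ 2 - ∫ r, lkIntegrand u r ∂ν) u :=
      ContinuousAt.sub (by fun_prop) (hν.continuousAt_integral hu)
    refine h1.congr ?_
    filter_upwards [Ioi_mem_nhds hu] with v hv
    exact (hform v (le_of_lt hv)).symm
  have hpos : ∀ u, 1 / 2 < u → 0 < Ψ u := fun u hu =>
    pos_of_largestZero_lt (eventually_pos_of_eq_sq_div hlt hΨl) hcont (by linarith)
      (hθ.trans_lt hu)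
  -- Only the limit from the right is available, since 1/2 may itself be the largest zero.
  have hhalf : 0 ≤ Ψ (1 / 2) := by
    have h1 : Tendsto Ψ (𝓝[>] (1 / 2)) (𝓝 (Ψ (1 / 2))) :=
      (hcont (1 / 2) (by norm_num)).tendsto.mono_left nhdsWithin_le_nhds
    exact ge_of_tendsto h1 (eventually_nhdsWithin_of_forall fun u hu => (hpos u hu).le)
  have hid : ∀ u, 1 / 2 < u → Ψ (1 / 2) / (2 * u - 1) + κ / (2 * u) +
      (2 * u * (∫ r, lkIntegrand (1 / 2) r ∂ν) - ∫ r, lkIntegrand u r ∂ν) /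
        (2 * u * (2 * u - 1)) = Ψ u / (2 * u * (2 * u - 1)) - σ ^ 2 / 8 := by
    intro u hu
    rw [hform u (by linarith), hform (1 / 2) (by norm_num)]
    have h1 : 2 * u - 1 ≠ 0 := by linarith
    have h2 : u ≠ 0 := by linarith
    generalize ∫ r, lkIntegrand (1 / 2) r ∂ν = A
    generalize ∫ r, lkIntegrand u r ∂ν = B
    have h3 : u = ((2 * u - 1) + 1) / 2 := by ring
    generalize 2 * u - 1 = d at h1 h3 ⊢
    subst h3
    have h4 : d + 1 ≠ 0 := fun h => h2 (by rw [h]; simp)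
    field_simp
    ring
  -- The left side of `hid` is nonnegative, so σ²/8 ≤ Ψ(u)/(2u(2u-1)) ≤ 1/ℓ(u) → 0.
  have hσ : σ = 0 := by
    have h1 : ∀ᶠ u : ℝ in atTop, σ ^ 2 / 8 ≤ (l u)⁻¹ := by
      filter_upwards [hΨl, hlt.eventually_gt_atTop 0, eventually_ge_atTop 1] with u e1 e2 e3
      have h2 := hid u (by linarith)
      have h3 := (hν.lintegral_lkDensity hhalf hκ (show 1 / 2 < u by linarith)).2
      have h4 : 0 < 2 * u - 1 := by linarith
      have h5 : Ψ u / (2 * u * (2 * u - 1)) ≤ (l u)⁻¹ := by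
        rw [e1, div_le_iff₀ (by positivity), div_eq_mul_inv, mul_comm]
        gcongr
        nlinarith
      have h6 : 0 ≤ Ψ (1 / 2) / (2 * u - 1) + κ / (2 * u) := by positivity
      linarith
    have h2 := ge_of_tendsto (tendsto_inv_atTop_zero.comp hlt) h1
    have h3 : σ ^ 2 = 0 := le_antisymm (by linarith) (sq_nonneg σ)
    exact pow_eq_zero_iff two_ne_zero |>.1 h3
  set g := lkDensity (Ψ (1 / 2)) κ ν with hg_def
  have hg : Measurable g := measurable_lkDensity _ _
  set ρ := (volume.restrict (Ioi (0 : ℝ))).withDensity g with hρ_def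
  have hcast : ∀ k : ℕ, 1 ≤ k → (1 : ℝ) / 2 < k := fun k hk => by
    have : (1 : ℝ) ≤ k := by exact_mod_cast hk
    linarith
  have hcpos : ∀ k : ℕ, 1 ≤ k → 0 < coeffRatio Ψ k := by
    intro k hk
    have h1 := hcast k hk
    have h2 := hpos k h1
    have h3 : 0 < 2 * (k : ℝ) - 1 := by linarith
    unfold coeffRatio
    positivity
  have hlap : ∀ k : ℕ, 1 ≤ k →
      ∫⁻ y, ENNReal.ofReal (Real.exp (-(k * y))) ∂ρ = ENNReal.ofReal (coeffRatio Ψ k)⁻¹ := by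
    intro k hk
    rw [hρ_def, lintegral_withDensity_eq_lintegral_mul _ hg (by fun_prop)]
    simp only [Pi.mul_apply, mul_comm (g _)]
    rw [(hν.lintegral_lkDensity hhalf hκ (hcast k hk)).1, hid _ (hcast k hk), coeffRatio, inv_div, hσ]
    simp
  have hpae : ∀ᵐ y ∂ρ, 0 < y :=
    (withDensity_absolutelyContinuous _ _).ae_le (ae_restrict_mem measurableSet_Ioi)
  refine ⟨ρ, ⟨⟨hcpos, fun k m hk hkm => ?_, tendsto_coeffRatio_double hl hlt hΨl⟩, hpae, hlap⟩,
    (withDensity_absolutelyContinuous _ _).trans Measure.restrict_le_self.absolutelyContinuous, ?_⟩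
  · have h1 : ENNReal.ofReal (coeffRatio Ψ m)⁻¹ ≤ ENNReal.ofReal (coeffRatio Ψ k)⁻¹ := by
      rw [← hlap k hk, ← hlap m (hk.trans hkm)]
      refine lintegral_mono_ae ?_
      filter_upwards [hpae] with y hy
      gcongr
    have hp := hcpos k hk
    rw [ENNReal.ofReal_le_ofReal_iff (by positivity)] at h1
    exact (inv_le_inv₀ (hcpos m (hk.trans hkm)) hp).1 h1
  -- If g vanished on (0, ∞), then ρ = 0, against its positive Laplace transform at 1.
  · have hex : ∃ R, 0 < R ∧ g R ≠ 0 := by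
      by_contra hc
      push Not at hc
      have h1 := hlap 1 le_rfl
      have h2 : ρ = 0 := by
        rw [hρ_def, withDensity_eq_zero_iff hg.aemeasurable]
        exact (ae_restrict_iff' measurableSet_Ioi).2 (Eventually.of_forall hc)
      rw [h2, lintegral_zero_measure, eq_comm, ENNReal.ofReal_eq_zero] at h1
      exact absurd (inv_pos.2 (hcpos 1 le_rfl)) (not_lt.2 h1)
    obtain ⟨R, hR, hgR⟩ := hex
    exact ⟨R, hR, fun y hy => mem_support_withDensity_restrict hg
      (fun z hz => lkDensity_pos_of_le hhalf hκ hz.2.le hgR) hy⟩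

end

end VanDantzig

/-! ### Order and type -/

namespace VanDantzig

variable {h : ℕ → ℝ}

/-- The value `∑ b n r^(2 n) / (2 n)!` of the even series at `i r`. -/
noncomputable def evenMajorant (b : ℕ → ℝ) (r : ℝ) : ℝ :=
  ∑' n : ℕ, b n / ((2 * n).factorial : ℝ) * r ^ (2 * n)

/-- At z = ir the signs cancel and all terms are nonnegative, so the triangle inequality is
attained. -/
lemma maxModulus_evenSeries {b : ℕ → ℝ} (hb : EvenSummable b) (hb0 : ∀ n, 0 ≤ b n) {r : ℝ}
    (hr : 0 ≤ r) : maxModulus (evenSeries b) r = evenMajorant b r := by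
  have hnn : 0 ≤ evenMajorant b r := tsum_nonneg fun n => by have := hb0 n; positivity
  refine IsGreatest.csSup_eq ⟨⟨Complex.I * r, by simp [abs_of_nonneg hr], ?_⟩, ?_⟩
  · have : evenSeries b (Complex.I * r) = (evenMajorant b r : ℂ) := by
      rw [evenSeries, evenMajorant, Complex.ofReal_tsum]
      refine tsum_congr fun n => ?_
      rw [mul_pow, pow_mul, Complex.I_sq]
      push_cast
      have : ((-1 : ℂ) ^ n) * (-1) ^ n = 1 := by rw [← mul_pow]; simp
      linear_combination (b n : ℂ) / ((2 * n).factorial : ℂ) * (r : ℂ) ^ (2 * n) * this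
    simp only [this, Complex.norm_real, Real.norm_eq_abs, abs_of_nonneg hnn]
  · rintro _ ⟨z, hz, rfl⟩
    have hz' : ‖z‖ = r := by simpa using hz
    have h1 : ∀ n, ‖(((-1) ^ n * b n / ((2 * n).factorial : ℝ) : ℝ) : ℂ) * z ^ (2 * n)‖ =
        b n / ((2 * n).factorial : ℝ) * r ^ (2 * n) := fun n => by
      rw [norm_evenSeries_term, abs_of_nonneg (hb0 n), hz']
    have h2 := norm_tsum_le_tsum_norm (hb.summable z).norm
    simp_rw [h1] at h2
    exact h2

/-- The quotient by K^n is nondecreasing once h ≥ K, so its minimum over an initial segment serves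
as c. -/
lemma exists_mul_pow_le_shiftedProd (H : SlowlyIncreasing h) (htop : Tendsto h atTop atTop)
    {K : ℝ} (hK : 0 < K) : ∃ c, 0 < c ∧ ∀ n, c * K ^ n ≤ shiftedProd h 0 n := by
  obtain ⟨N, hN⟩ := eventually_atTop.1 (htop.eventually_ge_atTop K)
  obtain ⟨i, -, hi⟩ := Finset.exists_min_image (Finset.range (N + 1))
    (fun n => shiftedProd h 0 n / K ^ n) ⟨0, by simp⟩
  refine ⟨shiftedProd h 0 i / K ^ i, div_pos (shiftedProd_pos H _ _) (by positivity), fun n => ?_⟩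
  rw [← le_div_iff₀ (by positivity)]
  rcases le_total n N with hn | hn
  · exact hi n (by simp; omega)
  · induction n, hn using Nat.le_induction with
    | base => exact hi N (by simp)
    | succ n hn ih =>
      refine ih.trans ?_
      rw [shiftedProd_succ, pow_succ, mul_div_mul_comm]
      refine le_mul_of_one_le_right (div_pos (shiftedProd_pos H _ _) (by positivity)).le ?_
      rw [zero_add, one_le_div hK]
      exact hN _ (by omega)

lemma exists_exp_le_evenMajorant (H : SlowlyIncreasing h) (htop : Tendsto h atTop atTop)
    {K : ℝ} (hK : 0 < K) :
    ∃ c, 0 < c ∧ ∀ r, c * Real.exp (K * r) ≤ evenMajorant (shiftedProd h 0) r := by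
  obtain ⟨c, hc, hcs⟩ := exists_mul_pow_le_shiftedProd H htop (pow_pos hK 2)
  have hS := H.evenSummable 0
  refine ⟨c / 2, by positivity, fun r => ?_⟩
  have h1 : c / 2 * Real.exp (K * r) ≤ c * Real.cosh (K * r) := by
    rw [Real.cosh_eq]
    have := Real.exp_pos (-(K * r))
    nlinarith
  refine h1.trans ?_
  have h2 := (Real.hasSum_cosh (K * r)).mul_left c
  rw [← h2.tsum_eq]
  refine Summable.tsum_le_tsum (fun n => ?_) h2.summable ?_
  · calc c * ((K * r) ^ (2 * n) / ((2 * n).factorial : ℝ))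
        = (c * (K ^ 2) ^ n) / ((2 * n).factorial : ℝ) * r ^ (2 * n) := by
          rw [mul_pow, pow_mul K]; ring
      _ ≤ _ := by
        have : 0 ≤ r ^ (2 * n) := by rw [pow_mul]; positivity
        gcongr
        exact hcs n
  · have := hS r
    simpa only [abs_of_pos (shiftedProd_pos H _ _)] using this

/-- With p = 2 - ε and x^p = Cr², the n-th term is at most y^p for y = x^n/n!. Since y ≤ e^x, it is
at most y·e^((p-1)x), and the sum is at most e^(px). -/
lemma exists_evenMajorant_le_exp (H : SlowlyIncreasing h) {ε : ℝ} (hε : 0 < ε) (hε1 : ε ≤ 1) :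
    ∃ C, 0 < C ∧ ∀ r, 0 < r →
      evenMajorant (shiftedProd h 0) r ≤ Real.exp (C * r ^ (2 / (2 - ε))) := by
  obtain ⟨C, hC, hCs⟩ := shiftedProd_le H hε
  have hp : 1 ≤ 2 - ε := by linarith
  set p := 2 - ε with hp_def
  have hp0 : 0 < p := by linarith
  have hS := H.evenSummable 0
  refine ⟨p * C ^ (1 / p), by positivity, fun r hr => ?_⟩
  set x := (C * r ^ 2) ^ (1 / p) with hx_def
  have hx : 0 < x := by positivity
  have hxp : x ^ p = C * r ^ 2 := by
    rw [hx_def, ← Real.rpow_mul (by positivity), one_div_mul_cancel hp0.ne', Real.rpow_one]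
  have hxr : x = C ^ (1 / p) * r ^ (2 / p) := by
    rw [hx_def, Real.mul_rpow hC.le (by positivity), ← Real.rpow_natCast r 2,
      ← Real.rpow_mul hr.le]
    congr 2
    push_cast
    ring
  rw [mul_assoc, ← hxr]
  have hterm : ∀ n, shiftedProd h 0 n / ((2 * n).factorial : ℝ) * r ^ (2 * n) ≤
      x ^ n / (n.factorial : ℝ) * Real.exp x ^ (p - 1) := by
    intro n
    have h1 := hCs 0 n
    rw [Nat.cast_zero, zero_add, Real.one_rpow, mul_one] at h1
    have hf : (0 : ℝ) < n.factorial := by positivity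
    set y := x ^ n / (n.factorial : ℝ) with hy
    have hy0 : 0 < y := by positivity
    have h2 : y ≤ Real.exp x := Real.pow_div_factorial_le_exp x hx.le n
    calc shiftedProd h 0 n / ((2 * n).factorial : ℝ) * r ^ (2 * n)
        ≤ (C ^ n * (n.factorial : ℝ) ^ ε) / (n.factorial : ℝ) ^ 2 * r ^ (2 * n) := by
          gcongr
          exact factorial_sq_le n
      _ = (C * r ^ 2) ^ n / (n.factorial : ℝ) ^ p := by
          rw [hp_def, Real.rpow_sub hf, mul_pow, ← pow_mul, Real.rpow_two]
          field_simp
      _ = y ^ p := by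
          rw [hy, Real.div_rpow (by positivity) hf.le, ← hxp, ← Real.rpow_natCast (x ^ p) n,
            ← Real.rpow_natCast x n, ← Real.rpow_mul hx.le, ← Real.rpow_mul hx.le, mul_comm p]
      _ = y * y ^ (p - 1) := by
          rw [Real.rpow_sub_one hy0.ne']
          field_simp
      _ ≤ y * Real.exp x ^ (p - 1) := by
          gcongr
  have hsum : HasSum (fun n : ℕ => x ^ n / (n.factorial : ℝ) * Real.exp x ^ (p - 1))
      (Real.exp x * Real.exp x ^ (p - 1)) := by
    refine HasSum.mul_right _ ?_
    rw [Real.exp_eq_exp_ℝ]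
    exact NormedSpace.expSeries_div_hasSum_exp x
  have h3 : evenMajorant (shiftedProd h 0) r ≤ Real.exp x * Real.exp x ^ (p - 1) := by
    rw [← hsum.tsum_eq]
    refine Summable.tsum_le_tsum hterm ?_ hsum.summable
    have := hS r
    simpa only [abs_of_pos (shiftedProd_pos H _ _)] using this
  refine h3.trans (le_of_eq ?_)
  rw [← Real.exp_mul, ← Real.exp_add]
  ring_nf

lemma eventually_mul_le_log_evenMajorant (H : SlowlyIncreasing h) (htop : Tendsto h atTop atTop)
    {K : ℝ} (hK : 0 < K) :
    ∀ᶠ r : ℝ in atTop, K * r ≤ Real.log (evenMajorant (shiftedProd h 0) r) := by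
  obtain ⟨c, hc, hcM⟩ := exists_exp_le_evenMajorant H htop (K := K + 1) (by linarith)
  filter_upwards [eventually_ge_atTop (-Real.log c)] with r hr
  have h1 := Real.log_le_log (by positivity) (hcM r)
  rw [Real.log_mul hc.ne' (Real.exp_pos _).ne', Real.log_exp] at h1
  linarith

lemma eventually_maxModulus_eq (H : SlowlyIncreasing h) :
    ∀ᶠ r : ℝ in atTop, maxModulus (evenSeries (shiftedProd h 0)) r =
      evenMajorant (shiftedProd h 0) r := by
  filter_upwards [eventually_ge_atTop 0] with r hr
  exact maxModulus_evenSeries (H.evenSummable 0) (fun n => (shiftedProd_pos H 0 n).le) hr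

lemma entireType_evenSeries (H : SlowlyIncreasing h) (htop : Tendsto h atTop atTop) :
    entireType (evenSeries (shiftedProd h 0)) 1 = ⊤ := by
  rw [EReal.eq_top_iff_forall_lt]
  intro y
  refine lt_of_lt_of_le (b := ((|y| + 1 : ℝ) : EReal))
    (EReal.coe_lt_coe_iff.2 (by linarith [le_abs_self y])) ?_
  refine le_trans ?_ (liminf_le_limsup (f := atTop))
  refine le_liminf_of_le (by isBoundedDefault) ?_
  filter_upwards [eventually_maxModulus_eq H, eventually_gt_atTop 0,
    eventually_mul_le_log_evenMajorant H htop (K := |y| + 1) (by positivity)] with r h1 h2 h3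
  rw [h1, Real.rpow_one, EReal.coe_le_coe_iff, le_div_iff₀ h2]
  exact h3

lemma entireOrder_evenSeries (H : SlowlyIncreasing h) (htop : Tendsto h atTop atTop) :
    entireOrder (evenSeries (shiftedProd h 0)) = 1 := by
  refine le_antisymm ?_ ?_
  · rw [← EReal.coe_one, ← EReal.le_of_forall_lt_iff_le]
    intro b hb
    have hb1 : 1 < b := EReal.coe_lt_coe_iff.1 hb
    -- One ε covers 2/(2-ε) ≤ 1 + ε (as ε ≤ 1), another absorbs log C into ε log r, and 1 + 2ε ≤ b.
    set ε := min 1 ((b - 1) / 2) with hε_def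
    have hε : 0 < ε := lt_min one_pos (by linarith)
    have hε1 : ε ≤ 1 := min_le_left _ _
    have hε2 : ε ≤ (b - 1) / 2 := min_le_right _ _
    obtain ⟨C, hC, hM⟩ := exists_evenMajorant_le_exp H hε hε1
    refine limsup_le_of_le (by isBoundedDefault) ?_
    filter_upwards [eventually_maxModulus_eq H, eventually_gt_atTop 1,
      eventually_mul_le_log_evenMajorant H htop one_pos,
      Real.tendsto_log_atTop.eventually_ge_atTop (Real.log C / ε)] with r h1 h2 h3 h4
    have hr0 : 0 < r := by linarith
    have hlr : 0 < Real.log r := Real.log_pos h2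
    rw [h1, EReal.coe_le_coe_iff, div_le_iff₀ hlr]
    have h5 : 0 < Real.log (evenMajorant (shiftedProd h 0) r) := by linarith
    have h6 : 0 < evenMajorant (shiftedProd h 0) r := by
      obtain ⟨c, hc, hcM⟩ := exists_exp_le_evenMajorant H htop one_pos
      exact lt_of_lt_of_le (by positivity) (hcM r)
    have h7 := Real.log_le_log h6 (hM r hr0)
    rw [Real.log_exp] at h7
    have h8 := Real.log_le_log h5 h7
    rw [Real.log_mul hC.ne' (by positivity), Real.log_rpow hr0] at h8
    have h9 : 2 / (2 - ε) ≤ 1 + ε := by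
      rw [div_le_iff₀ (by linarith)]
      nlinarith
    rw [div_le_iff₀ hε] at h4
    nlinarith
  · refine le_trans ?_ (liminf_le_limsup (f := atTop))
    refine le_liminf_of_le (by isBoundedDefault) ?_
    filter_upwards [eventually_maxModulus_eq H, eventually_gt_atTop 1,
      eventually_mul_le_log_evenMajorant H htop one_pos] with r h1 h2 h3
    rw [h1, ← EReal.coe_one, EReal.coe_le_coe_iff, le_div_iff₀ (Real.log_pos h2), one_mul]
    exact Real.log_le_log (by linarith) (by linarith)

end VanDantzig

/-! ### Densities and the special Bernstein case -/

namespace VanDantzig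

lemma exists_density {lam : Measure ℝ} [IsFiniteMeasure lam] (h : lam ≪ volume) :
    ∃ f : ℝ → ℝ, Measurable f ∧ (∀ x, 0 ≤ f x) ∧
      (volume.withDensity fun x => ENNReal.ofReal (f x)) = lam := by
  refine ⟨fun x => (lam.rnDeriv volume x).toReal, (Measure.measurable_rnDeriv _ _).ennreal_toReal,
    fun x => ENNReal.toReal_nonneg, ?_⟩
  nth_rewrite 2 [← Measure.withDensity_rnDeriv_eq lam volume h]
  refine withDensity_congr_ae ?_
  filter_upwards [Measure.rnDeriv_ne_top lam volume] with x hx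
  exact ENNReal.ofReal_toReal hx

lemma tendsto_div_sub_atTop (θ : ℝ) : Tendsto (fun u : ℝ => u / (u - θ)) atTop (𝓝 1) := by
  have h1 : Tendsto (fun u : ℝ => (1 - θ * u⁻¹)⁻¹) atTop (𝓝 (1 - θ * 0)⁻¹) :=
    ((tendsto_inv_atTop_zero.const_mul θ).const_sub 1).inv₀ (by simp)
  simp only [mul_zero, sub_zero, inv_one] at h1
  refine h1.congr' ?_
  filter_upwards [eventually_gt_atTop 0, eventually_gt_atTop θ] with u h2 h3
  have : u - θ ≠ 0 := by linarith
  rw [← div_eq_mul_inv, one_sub_div h2.ne', inv_div]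

-- The factor u/(u-θ) tends to 1, so slow variation is inherited. The value 1 on u ≤ θ is an
-- arbitrary measurable filling.
open Classical in
lemma isSlowlyVarying_div_sub_mul {θ : ℝ} {ψ : ℝ → ℝ} (hψ : IsSlowlyVarying ψ) :
    IsSlowlyVarying fun u => if θ < u then u / (u - θ) * ψ u else 1 := by
  constructor
  · refine Measurable.ite (measurableSet_lt measurable_const measurable_subtype_coe) ?_
      measurable_const
    exact (measurable_subtype_coe.div (measurable_subtype_coe.sub_const θ)).mul hψ.1
  · intro u hu
    have ht : Tendsto (fun t : ℝ => u * t) atTop atTop := tendsto_id.const_mul_atTop hu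
    have h1 := (((tendsto_div_sub_atTop θ).comp ht).div (tendsto_div_sub_atTop θ)
      one_ne_zero).mul (hψ.2 u hu)
    rw [div_one, one_mul] at h1
    refine h1.congr' ?_
    filter_upwards [eventually_gt_atTop θ, ht.eventually_gt_atTop θ] with t h2 h3
    simp only [Pi.div_apply, Function.comp_apply, if_pos h2, if_pos h3]
    rw [div_mul_div_comm]

end VanDantzig

theorem mainTheorem11 (Ψ : ℝ → ℝ) (hΨ : VanDantzig.MemND Ψ) :
    -- the consequences of `Ψ(u) = u² / l(u)`
    (∀ l : ℝ → ℝ, VanDantzig.IsSlowlyVarying l → Tendsto l atTop atTop →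
      (∀ᶠ u : ℝ in atTop, Ψ u = u ^ 2 / l u) →
        ((∀ z : ℂ, Summable (VanDantzig.seriesTerm Ψ z)) ∧
          Differentiable ℂ (VanDantzig.J Ψ) ∧
          VanDantzig.entireOrder (VanDantzig.J Ψ) = 1 ∧
          VanDantzig.entireType (VanDantzig.J Ψ) 1 = ⊤) ∧
        ∃ f : ℝ → ℝ, Measurable f ∧ (∀ x, 0 ≤ f x) ∧
          IsProbabilityMeasure (volume.withDensity fun x => ENNReal.ofReal (f x)) ∧
          (∀ t : ℝ, charFun (volume.withDensity fun x => ENNReal.ofReal (f x)) t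
            = VanDantzig.J Ψ (t : ℂ)) ∧
          (volume.withDensity fun x => ENNReal.ofReal (f x)).support = univ) ∧
    -- the condition holds in the special Bernstein case
    (∀ (θ : ℝ) (φ ψ : ℝ → ℝ), 0 ≤ θ →
      VanDantzig.IsSpecialBernsteinWithConjugate φ ψ →
      (∀ u : ℝ, 0 < u → Ψ u = (u - θ) * φ u) →
      VanDantzig.IsSlowlyVarying ψ → Tendsto ψ atTop atTop →
        ∃ l : ℝ → ℝ, (∀ u : ℝ, θ < u → l u = u / (u - θ) * ψ u) ∧
          VanDantzig.IsSlowlyVarying l ∧ Tendsto l atTop atTop ∧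
          ∀ u : ℝ, θ < u → Ψ u = u ^ 2 / l u) := by
  classical
  refine ⟨fun l hl hlt hΨl => ?_, fun θ φ ψ hθ hφ hΨφ hψ hψt => ?_⟩
  · obtain ⟨ρ, L, hρ, R, hR, hsupp⟩ :=
      VanDantzig.exists_isLaplaceInverse_coeffRatio hΨ hl hlt hΨl
    have htop := VanDantzig.tendsto_coeffRatio_atTop hlt hΨl
    have hS := L.slow.evenSummable 0
    rw [VanDantzig.J_eq_evenSeries]
    refine ⟨⟨fun z => ?_, hS.differentiable, VanDantzig.entireOrder_evenSeries L.slow htop,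
      VanDantzig.entireType_evenSeries L.slow htop⟩, ?_⟩
    · simp_rw [funext (VanDantzig.seriesTerm_eq Ψ z)]
      exact hS.summable z
    · obtain ⟨f, hf, hf0, hflam⟩ := VanDantzig.exists_density (L.law_absolutelyContinuous hρ)
      refine ⟨f, hf, hf0, ?_⟩
      rw [hflam]
      exact ⟨inferInstance, L.charFun_law 0, L.support_law htop hR hsupp⟩
  · refine ⟨fun u => if θ < u then u / (u - θ) * ψ u else 1, fun u hu => if_pos hu,
      VanDantzig.isSlowlyVarying_div_sub_mul hψ, ?_, fun u hu => ?_⟩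
    · refine ((VanDantzig.tendsto_div_sub_atTop θ).pos_mul_atTop one_pos hψt).congr' ?_
      filter_upwards [eventually_gt_atTop θ] with u hu
      exact (if_pos hu).symm
    · have hu0 : 0 < u := hθ.trans_lt hu
      -- Substituting φ = u/ψ into (u-θ)φ gives u² divided by uψ/(u-θ).
      have h1 := hφ.2.2 u hu0
      have h2 : ψ u ≠ 0 := fun h => by simp [h, hu0.ne] at h1
      have h3 : u - θ ≠ 0 := by linarith
      simp only [if_pos hu]
      rw [hΨφ u hu0, eq_div_iff (by positivity)]
      field_simp
      exact h1
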